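/- Setting. Let $t_0<T$, $\Delta t_0:=T-t_0$, $x^0\in\mathbb R^d$. Let $N:[t_0,T]\times\mathbb R^d\to\mathbb R^d$, $(t,x)\mapsto N_t(x)$, be such that $t\mapsto N_t(x)$ belongs to $L^\infty(t_0,T)$ for every $x$, $x\mapsto N_t(x)$ is $C^2$ for every $t$, and, for some $\Lambda_1,\Lambda_2>0$, $\|DN_t(x)\|\le\Lambda_1$ and $\|D^2N_t(x)\|\le\Lambda_2$ for all $(t,x)\in[t_0,T]\times\mathbb R^d$. Let $B\in L^\infty((t_0,T)\times\mathbb R^d;\mathbb R^{d\times k})$ be such that $x\mapsto B(t,x)$ is $C^1$ for every $t\in[t_0,T]$ and $\|D_xB(t,x)\|\le L_B$ for all $(t,x)\in[t_0,T]\times\mathbb R^d$, for some $L_B\ge0$. Matrices carry the spectral norm, and $\|B\|_\infty$ is the essential supremum of $\|B(t,x)\|$ over $(t_0,T)\times\mathbb R^d$. Let $\Phi_{s,t}$, $(s,t)\in[t_0,T]^2$, be the flow of $\dot x(t)=N_t(x(t))$ from time $s$ to time $t$, and, for $u\in L^\infty((t_0,T);\mathbb R^k)$, let $x_u$ be the absolutely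 continuous solution on $[t_0,T]$ of $$\dot x(t)=N_t(x(t))+B(t,x(t))\,u(t),\qquad x(t_0)=x^0.$$ With $\tau_1:=t_0$, $\tau_2:=T$, put for $i\in\{1,2\}$ $$\mathcal N_i(u):=\int_{t_0}^{T}D\Phi_{t,\tau_i}(x_u(t))\,B(t,x_u(t))\,B(t,x_u(t))^\top D\Phi_{t,\tau_i}(x_u(t))^\top\,dt .$$ Lemma. The flow and the trajectories $x_u$ exist and are unique, each $\Phi_{s,t}$ is differentiable on $\mathbb R^d$, the integrals defining $\mathcal N_1(u),\mathcal N_2(u)$ converge absolutely, and for $i\in\{1,2\}$ the map $u\mapsto\mathcal N_i(u)$ is continuous from $L^\infty((t_0,T);\mathbb R^k)$, with the norm $\|\cdot\|_\infty$, to the set of symmetric positive semi-definite $d\times d$ matrices. Moreover, let $\zeta_i\ge0$ and put $b_i:=L_B\zeta_i$. For $a,c\in\mathbb R$ write $E(a,c):=\frac{e^{a\Delta t_0}-e^{c\Delta t_0}}{a-c}$ if $a\ne c$ and $E(a,a):=\Delta t_0\,e^{a\Delta t_0}$. Then, for all $u,v\in L^\infty((t_0,T);\mathbb R^k)$ with $\|u\|_\infty\le\zeta_i$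 and $\|v\|_\infty\le\zeta_i$, and for each of the signs $\sigma\in\{1,-1\}$, $$\|\mathcal N_i(u)-\mathcal N_i(v)\|\le L_{\mathcal N_i}^{\sigma}\,\|u-v\|_\infty,\qquad i\in\{1,2\},$$ where $$\begin{aligned}L_{\mathcal N_1}^{\sigma}&:=\frac{L_B\|B\|_\infty^2e^{\Lambda_1\Delta t_0}}{\Lambda_1}\left[\frac{e^{(2\Lambda_1+b_1)\Delta t_0}-e^{\Lambda_1\Delta t_0}}{\Lambda_1+b_1}+\sigma\,\frac{e^{(2\Lambda_1+b_1)\Delta t_0}-e^{-\Lambda_1\Delta t_0}}{b_1+3\Lambda_1}\right]\\ &\quad+\frac{2\|B\|_\infty^3\Lambda_2e^{\Lambda_1\Delta t_0}}{\Lambda_1(\Lambda_1+b_1)}\left[\frac{e^{(3\Lambda_1+b_1)\Delta t_0}-e^{-\Lambda_1\Delta t_0}}{4\Lambda_1+b_1}-\frac{e^{(2\Lambda_1+b_1)\Delta t_0}-e^{-\Lambda_1\Delta t_0}}{3\Lambda_1+b_1}+\frac{e^{\Lambda_1\Delta t_0}-e^{-\Lambda_1\Delta t_0}}{2\Lambda_1}-\frac{e^{2\Lambda_1\Delta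 t_0}-e^{-\Lambda_1\Delta t_0}}{3\Lambda_1}\right],\\ L_{\mathcal N_2}^{\sigma}&:=\frac{L_B\|B\|_\infty^2e^{\Lambda_1\Delta t_0}}{\Lambda_1}\left[E(\Lambda_1,b_2)-\frac{e^{b_2\Delta t_0}-e^{-\Lambda_1\Delta t_0}}{b_2+\Lambda_1}\right]\\ &\quad+\frac{2\|B\|_\infty^3\Lambda_2e^{\Lambda_1\Delta t_0}}{\Lambda_1(\Lambda_1+b_2)}\left[E(2\Lambda_1,b_2)+\sigma\,E(\Lambda_1,b_2)+\frac{e^{\Lambda_1\Delta t_0}-e^{-\Lambda_1\Delta t_0}}{2\Lambda_1}-\frac{e^{2\Lambda_1\Delta t_0}-e^{-\Lambda_1\Delta t_0}}{3\Lambda_1}\right].\end{aligned}$$ -/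

import Mathlib

open MeasureTheory Set

noncomputable section

/-- The Euclidean space `ℝⁿ`. Matrices `ℝ^{m×n}` are identified with the continuous linear maps
`Vec n →L[ℝ] Vec m`: the operator norm is the spectral norm and the adjoint is the transpose. -/
abbrev Vec (n : ℕ) : Type := EuclideanSpace ℝ (Fin n)

/-- The controls `L^∞((t₀, T); ℝᵏ)` with the essential supremum norm. -/
abbrev Control (k : ℕ) (t₀ T : ℝ) : Type :=
  Lp (Vec k) ⊤ ((volume : Measure ℝ).restrict (Ioo t₀ T))

/-- `x` is, on `[t₀, T]`, an absolutely continuous (Carathéodory) solution of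
`ẋ(t) = f(t, x(t))`, `x(s) = ξ`, in integrated form; `s` may be any time in `[t₀, T]`. -/
def IsSolutionOn {d : ℕ} (f : ℝ → Vec d → Vec d) (t₀ T s : ℝ) (ξ : Vec d)
    (x : ℝ → Vec d) : Prop :=
  ContinuousOn x (Icc t₀ T) ∧
    IntervalIntegrable (fun r => f r (x r)) volume t₀ T ∧
      ∀ t ∈ Icc t₀ T, x t = ξ + ∫ r in s..t, f r (x r)

/-- On `[t₀, T]` the problem `ẋ(t) = f(t, x(t))`, `x(s) = ξ` has one and only one solution. -/
def HasUniqueSolutionOn {d : ℕ} (f : ℝ → Vec d → Vec d) (t₀ T s : ℝ) (ξ : Vec d) : Prop :=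
  ∃ x : ℝ → Vec d, IsSolutionOn f t₀ T s ξ x ∧
    ∀ y : ℝ → Vec d, IsSolutionOn f t₀ T s ξ y → EqOn y x (Icc t₀ T)

/-- The solution on `[t₀, T]` of `ẋ(t) = f(t, x(t))`, `x(s) = ξ`
(an arbitrary function if there is none). -/
def solution {d : ℕ} (f : ℝ → Vec d → Vec d) (t₀ T s : ℝ) (ξ : Vec d) : ℝ → Vec d :=
  Classical.epsilon (IsSolutionOn f t₀ T s ξ)

/-- The flow `Φ_{s,t}` of the nonautonomous vector field `N` on `[t₀, T]`, from time `s` to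
time `t` (forward or backward). -/
def flow {d : ℕ} (N : ℝ → Vec d → Vec d) (t₀ T s t : ℝ) : Vec d → Vec d :=
  fun ξ => solution N t₀ T s ξ t

/-- The right-hand side `N_t(x) + B(t, x) u(t)` of the control system. -/
def controlledField {d k : ℕ} {t₀ T : ℝ} (N : ℝ → Vec d → Vec d)
    (B : ℝ → Vec d → (Vec k →L[ℝ] Vec d)) (u : Control k t₀ T) : ℝ → Vec d → Vec d :=
  fun t x => N t x + B t x (u t)

/-- The trajectory `x_u` of the control system that starts from `x⁰` at time `t₀`. -/
def trajectory {d k : ℕ} {t₀ T : ℝ} (N : ℝ → Vec d → Vec d)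
    (B : ℝ → Vec d → (Vec k →L[ℝ] Vec d)) (x₀ : Vec d) (u : Control k t₀ T) : ℝ → Vec d :=
  solution (controlledField N B u) t₀ T t₀ x₀

/-- The matrix `K(u)(t) = DΦ_{t,τ}(x_u(t)) B(t, x_u(t))`. -/
def gramianFactor {d k : ℕ} {t₀ T : ℝ} (N : ℝ → Vec d → Vec d)
    (B : ℝ → Vec d → (Vec k →L[ℝ] Vec d)) (x₀ : Vec d) (τ : ℝ) (u : Control k t₀ T)
    (t : ℝ) : Vec k →L[ℝ] Vec d :=
  (fderiv ℝ (flow N t₀ T t τ) (trajectory N B x₀ u t)).comp (B t (trajectory N B x₀ u t))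

/-- The integrand `K(u)(t) K(u)(t)ᵀ` of the Gramian. -/
def gramianIntegrand {d k : ℕ} {t₀ T : ℝ} (N : ℝ → Vec d → Vec d)
    (B : ℝ → Vec d → (Vec k →L[ℝ] Vec d)) (x₀ : Vec d) (τ : ℝ) (u : Control k t₀ T)
    (t : ℝ) : Vec d →L[ℝ] Vec d :=
  (gramianFactor N B x₀ τ u t).comp (ContinuousLinearMap.adjoint (gramianFactor N B x₀ τ u t))

/-- The trajectory-dependent Gramian based at time `τ`; `τ = t₀` gives `𝒩₁(u)` and `τ = T`
gives `𝒩₂(u)`. -/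
def gramian {d k : ℕ} {t₀ T : ℝ} (N : ℝ → Vec d → Vec d)
    (B : ℝ → Vec d → (Vec k →L[ℝ] Vec d)) (x₀ : Vec d) (τ : ℝ) (u : Control k t₀ T) :
    Vec d →L[ℝ] Vec d :=
  ∫ t in t₀..T, gramianIntegrand N B x₀ τ u t

/-- `‖B‖_∞`, the norm of `B` in `L^∞((t₀, T) × ℝᵈ; ℝ^{d×k})`. -/
def inputSupNorm {d k : ℕ} (t₀ T : ℝ) (B : ℝ → Vec d → (Vec k →L[ℝ] Vec d)) : ℝ :=
  (eLpNorm (fun p : ℝ × Vec d => B p.1 p.2) ⊤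
    (((volume : Measure ℝ).restrict (Ioo t₀ T)).prod (volume : Measure (Vec d)))).toReal

/-- The quotient `(e^{aδ} - e^{bδ}) / (a - b)`, with its limit `δ e^{aδ}` as value at `a = b`. -/
def expQuot (δ a b : ℝ) : ℝ :=
  if a = b then δ * Real.exp (a * δ) else (Real.exp (a * δ) - Real.exp (b * δ)) / (a - b)

/-- The Lipschitz constant of `𝒩₁`, with `M = ‖B‖_∞`, `δ = T - t₀` and a sign `σ` in front of the
second term of the first bracket. -/
def lipConst₁ (σ Λ₁ Λ₂ L M ζ δ : ℝ) : ℝ :=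
  L * M ^ 2 * Real.exp (Λ₁ * δ) / Λ₁ *
      ((Real.exp ((2 * Λ₁ + L * ζ) * δ) - Real.exp (Λ₁ * δ)) / (Λ₁ + L * ζ)
        + σ * ((Real.exp ((2 * Λ₁ + L * ζ) * δ) - Real.exp (-(Λ₁ * δ))) / (L * ζ + 3 * Λ₁)))
    + 2 * M ^ 3 * Λ₂ * Real.exp (Λ₁ * δ) / (Λ₁ * (Λ₁ + L * ζ)) *
      ((Real.exp ((3 * Λ₁ + L * ζ) * δ) - Real.exp (-(Λ₁ * δ))) / (4 * Λ₁ + L * ζ)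
        - (Real.exp ((2 * Λ₁ + L * ζ) * δ) - Real.exp (-(Λ₁ * δ))) / (3 * Λ₁ + L * ζ)
        + (Real.exp (Λ₁ * δ) - Real.exp (-(Λ₁ * δ))) / (2 * Λ₁)
        - (Real.exp (2 * Λ₁ * δ) - Real.exp (-(Λ₁ * δ))) / (3 * Λ₁))

/-- The Lipschitz constant of `𝒩₂`, with `M = ‖B‖_∞`, `δ = T - t₀` and a sign `σ` in front of the
second term of the second bracket. -/
def lipConst₂ (σ Λ₁ Λ₂ L M ζ δ : ℝ) : ℝ :=
  L * M ^ 2 * Real.exp (Λ₁ * δ) / Λ₁ *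
      (expQuot δ Λ₁ (L * ζ)
        - (Real.exp (L * ζ * δ) - Real.exp (-(Λ₁ * δ))) / (L * ζ + Λ₁))
    + 2 * M ^ 3 * Λ₂ * Real.exp (Λ₁ * δ) / (Λ₁ * (Λ₁ + L * ζ)) *
      (expQuot δ (2 * Λ₁) (L * ζ)
        + σ * expQuot δ Λ₁ (L * ζ)
        + (Real.exp (Λ₁ * δ) - Real.exp (-(Λ₁ * δ))) / (2 * Λ₁)
        - (Real.exp (2 * Λ₁ * δ) - Real.exp (-(Λ₁ * δ))) / (3 * Λ₁))

end

/-! The Lipschitz bound is an estimate pointwise in `t`, integrated exactly. Write M = ‖B‖_∞, b =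
L_B ζ, X = exp(Λ₁|t-τ|), Y = exp((Λ₁+b)(t-t₀)). Gronwall arguments give ‖DΦ_{t,τ}‖ ≤ X, the
Lipschitz constant Λ₂X(X-1)/Λ₁ for DΦ_{t,τ} (`norm_fderiv_flow_sub_le`), and ‖x_u(t)-x_v(t)‖ ≤
M‖u-v‖(Y-1)/(Λ₁+b) (`norm_trajectory_sub_le`). With K = DΦ·B, telescoping first K_uK_uᵀ - K_vK_vᵀ
and then K_u - K_v bounds the difference of the integrands by 2MX · (L_B X + MΛ₂X(X-1)/Λ₁) · ‖x_u -
x_v‖ (`norm_gramian_sub_le`). Expanded, this is a sum of exponentials whose integral is exactly the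
constant with σ = -1; σ = 1 only adds a nonnegative term.

Since the data are merely measurable in time, solutions are Carathéodory solutions. Both existence
(`IsCaratheodory.exists_solution`) and the comparison principle (`norm_le_of_integral_eq`) use the
weight exp(-l|t-s|), which covers all of [t₀, T], forward and backward, in one step. The flow is
differentiable because its first-order remainder, measured against the solution of the variational
equation, is quadratic (`exists_hasFDerivAt_flow`). -/

open Filter Topology

/-! ### Carathéodory equations: Gronwall comparison and global existence. -/

section Caratheodory

/-- On each of the finitely many fibres of a simple function the composite is some `f · x`;
continuity in the state passes to the limit of simple approximations. No joint measurability of `f`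
is required. -/
theorem aestronglyMeasurable_comp_of_continuous {α F G : Type*} [MeasurableSpace α]
    {μ : Measure α} [TopologicalSpace F] [TopologicalSpace G]
    [TopologicalSpace.PseudoMetrizableSpace G] {f : α → F → G}
    (hf : ∀ x, AEStronglyMeasurable (fun t => f t x) μ) (hc : ∀ᵐ t ∂μ, Continuous (f t))
    {y : α → F} (hy : StronglyMeasurable y) : AEStronglyMeasurable (fun t => f t (y t)) μ := by
  have simple : ∀ φ : SimpleFunc α F, AEStronglyMeasurable (fun t => f t (φ t)) μ := by
    intro φ
    have hU : (⋃ v : φ.range, φ ⁻¹' {v.1}) = univ := by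
      ext t
      simp
    rw [← Measure.restrict_univ (μ := μ), ← hU, aestronglyMeasurable_iUnion_iff]
    intro v
    refine (hf v.1).restrict.congr ?_
    refine ae_restrict_of_forall_mem (φ.measurableSet_fiber v.1) fun t ht => ?_
    simp only [mem_preimage, mem_singleton_iff] at ht
    simp only [ht]
  refine aestronglyMeasurable_of_tendsto_ae atTop (fun n => simple (hy.approx n)) ?_
  filter_upwards [hc] with t ht
  exact (ht.tendsto _).comp (hy.tendsto_approx t)

/-- Reduces forward and backward times to the single variable ρ = |t - s|. -/
theorem abs_integral_comp_abs_sub (g : ℝ → ℝ) (s t : ℝ) :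
    |(∫ r in s..t, g |r - s|)| = |(∫ ρ in (0 : ℝ)..|t - s|, g ρ)| := by
  rcases le_total s t with h | h
  · have : ∫ r in s..t, g |r - s| = ∫ r in s..t, g (r - s) := by
      refine intervalIntegral.integral_congr fun r hr => ?_
      rw [uIcc_of_le h] at hr
      simp only [abs_of_nonneg (sub_nonneg.2 hr.1)]
    rw [this, intervalIntegral.integral_comp_sub_right (fun ρ => g ρ), sub_self,
      abs_of_nonneg (sub_nonneg.2 h)]
  · have : ∫ r in s..t, g |r - s| = ∫ r in s..t, g (s - r) := by
      refine intervalIntegral.integral_congr fun r hr => ?_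
      rw [uIcc_of_ge h] at hr
      simp only [abs_sub_comm r s, abs_of_nonneg (sub_nonneg.2 hr.2)]
    rw [this, intervalIntegral.integral_comp_sub_left (fun ρ => g ρ), sub_self,
      abs_sub_comm t s, abs_of_nonneg (sub_nonneg.2 h), intervalIntegral.integral_symm, abs_neg]

theorem abs_integral_exp_abs_sub_le {l : ℝ} (hl : 0 < l) (s t : ℝ) :
    |∫ r in s..t, Real.exp (l * |r - s|)| ≤ Real.exp (l * |t - s|) / l := by
  rw [abs_integral_comp_abs_sub (fun ρ => Real.exp (l * ρ)) s t,
    intervalIntegral.integral_comp_mul_left (fun ρ => Real.exp ρ) hl.ne', integral_exp,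
    mul_zero, Real.exp_zero, smul_eq_mul, abs_of_nonneg]
  · rw [div_eq_inv_mul]
    exact mul_le_mul_of_nonneg_left (by linarith) (by positivity)
  · have : 1 ≤ Real.exp (l * |t - s|) := Real.one_le_exp (by positivity)
    exact mul_nonneg (by positivity) (by linarith)

variable {t₀ T s : ℝ}

theorem uIcc_subset_Icc_of_mem {t : ℝ} (hs : s ∈ Icc t₀ T) (ht : t ∈ Icc t₀ T) :
    uIcc s t ⊆ Icc t₀ T := by
  have h := hs.1.trans hs.2
  rw [← uIcc_of_le h] at *
  exact uIcc_subset_uIcc hs ht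

/-- Gronwall through a weighted maximum: the maximum `D` of exp(-l|t-s|) m⁺ satisfies D ≤ (K/l) D
with K/l < 1, so it vanishes. -/
theorem nonpos_of_le_abs_integral {m : ℝ → ℝ} {K : ℝ} (hK : 0 ≤ K)
    (hs : s ∈ Icc t₀ T) (hm : ContinuousOn m (Icc t₀ T))
    (h : ∀ t ∈ Icc t₀ T, m t ≤ |∫ r in s..t, K * max (m r) 0|) :
    ∀ t ∈ Icc t₀ T, m t ≤ 0 := by
  -- Any l > K would do; the summand 1 keeps l positive when K = 0.
  set l := 2 * K + 1 with hl
  have hl0 : 0 < l := by positivity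
  have hq : ContinuousOn (fun t => Real.exp (-(l * |t - s|)) * max (m t) 0) (Icc t₀ T) := by
    refine ContinuousOn.mul (by fun_prop) ?_
    exact hm.sup continuousOn_const
  obtain ⟨t', ht', hmax⟩ := isCompact_Icc.exists_isMaxOn ⟨s, hs⟩ hq
  set D := Real.exp (-(l * |t' - s|)) * max (m t') 0 with hD
  have hD0 : 0 ≤ D := by positivity
  have bound : ∀ r ∈ Icc t₀ T, max (m r) 0 ≤ D * Real.exp (l * |r - s|) := by
    intro r hr
    have h1 : Real.exp (-(l * |r - s|)) * max (m r) 0 ≤ D := hmax hr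
    calc max (m r) 0 = (Real.exp (-(l * |r - s|)) * max (m r) 0) * Real.exp (l * |r - s|) := by
          rw [mul_comm (Real.exp _) (max _ _), mul_assoc, ← Real.exp_add]; simp
      _ ≤ _ := by gcongr
  have step : ∀ t ∈ Icc t₀ T, m t ≤ K * D * (Real.exp (l * |t - s|) / l) := by
    intro t ht
    have hsub := uIcc_subset_Icc_of_mem hs ht
    refine (h t ht).trans ?_
    have h1 : ‖∫ r in s..t, K * max (m r) 0‖ ≤
        |∫ r in s..t, K * D * Real.exp (l * |r - s|)| := by
      refine intervalIntegral.norm_integral_le_abs_of_norm_le ?_ ?_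
      · refine ae_restrict_of_forall_mem measurableSet_uIoc fun r hr => ?_
        rw [Real.norm_of_nonneg (by positivity), mul_assoc]
        exact mul_le_mul_of_nonneg_left (bound r (hsub (uIoc_subset_uIcc hr))) hK
      · exact Continuous.intervalIntegrable (by fun_prop) _ _
    rw [Real.norm_eq_abs, intervalIntegral.integral_const_mul (K * D), abs_mul (K * D),
      abs_of_nonneg (mul_nonneg hK hD0)] at h1
    exact h1.trans (mul_le_mul_of_nonneg_left (abs_integral_exp_abs_sub_le hl0 s t)
      (mul_nonneg hK hD0))
  have hD' : D ≤ K * D / l := by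
    have h1 : max (m t') 0 ≤ K * D * (Real.exp (l * |t' - s|) / l) :=
      max_le (step t' ht') (by positivity)
    calc D ≤ Real.exp (-(l * |t' - s|)) * (K * D * (Real.exp (l * |t' - s|) / l)) := by
          rw [hD]; gcongr
      _ = K * D / l * (Real.exp (-(l * |t' - s|)) * Real.exp (l * |t' - s|)) := by ring
      _ = K * D / l := by rw [← Real.exp_add]; simp
  have hD1 : D = 0 := by
    rw [le_div_iff₀ hl0] at hD'
    nlinarith
  intro t ht
  have := bound t ht
  rw [hD1, zero_mul] at this
  exact (le_max_left _ _).trans this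

theorem ae_restrict_uIoc_of_Ioo {t : ℝ} {p : ℝ → Prop} (hs : s ∈ Icc t₀ T) (ht : t ∈ Icc t₀ T)
    (h : ∀ᵐ r ∂(volume.restrict (Ioo t₀ T)), p r) : ∀ᵐ r ∂(volume.restrict (uIoc s t)), p r := by
  rw [restrict_Ioo_eq_restrict_Ioc] at h
  refine ae_restrict_of_ae_restrict_of_subset ?_ h
  exact Ioc_subset_Ioc (le_min hs.1 ht.1) (max_le hs.2 ht.2)

variable {E : Type*} [NormedAddCommGroup E] [NormedSpace ℝ E]

/-- Comparison with the scalar equation ψ' = Kψ + g: the excess ‖z‖ - ψ(|t-s|) satisfies a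
homogeneous integral inequality. The condition `hψ0` makes the integral of ψ' nonnegative, so that
ψ(|t-s|) - ψ(0) is the absolute value of the integral from s to t also when t < s. -/
theorem norm_le_of_integral_eq {z Z : ℝ → E} {z₀ : E} {K : ℝ} (hK : 0 ≤ K) {g ψ : ℝ → ℝ}
    (hs : s ∈ Icc t₀ T) (hz : ContinuousOn z (Icc t₀ T)) (hg : Continuous g)
    (heq : ∀ t ∈ Icc t₀ T, z t = z₀ + ∫ r in s..t, Z r)
    (hZ : ∀ᵐ r ∂(volume.restrict (Ioo t₀ T)), ‖Z r‖ ≤ K * ‖z r‖ + g |r - s|)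
    (hψ : ∀ ρ, HasDerivAt ψ (K * ψ ρ + g ρ) ρ) (hψ0 : ∀ ρ, 0 ≤ ρ → ψ 0 ≤ ψ ρ)
    (hz₀ : ‖z₀‖ ≤ ψ 0) : ∀ t ∈ Icc t₀ T, ‖z t‖ ≤ ψ |t - s| := by
  have hψc : Continuous ψ := continuous_iff_continuousAt.2 fun ρ => (hψ ρ).continuousAt
  have key := nonpos_of_le_abs_integral (m := fun t => ‖z t‖ - ψ |t - s|) hK hs
    (hz.norm.sub (by fun_prop)) ?_
  · intro t ht
    linarith [key t ht]
  intro t ht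
  have hsub := uIcc_subset_Icc_of_mem hs ht
  have hzc : ContinuousOn (fun r => ‖z r‖) (uIcc s t) := (hz.mono hsub).norm
  have hi1 : IntervalIntegrable (fun r => K * max (‖z r‖ - ψ |r - s|) 0) volume s t :=
    ContinuousOn.intervalIntegrable (continuousOn_const.mul
      ((hzc.sub (by fun_prop)).sup continuousOn_const))
  have hi2 : IntervalIntegrable (fun r => K * ψ |r - s| + g |r - s|) volume s t :=
    Continuous.intervalIntegrable (by fun_prop) _ _
  have h1 : ‖z t‖ ≤ ψ 0 +
      |∫ r in s..t, ((K * ψ |r - s| + g |r - s|) + K * max (‖z r‖ - ψ |r - s|) 0)| := by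
    rw [heq t ht]
    refine (norm_add_le _ _).trans (add_le_add hz₀ ?_)
    refine intervalIntegral.norm_integral_le_abs_of_norm_le ?_ (hi2.add hi1)
    filter_upwards [ae_restrict_uIoc_of_Ioo hs ht hZ] with r hr
    have := mul_le_mul_of_nonneg_left (le_max_left (‖z r‖ - ψ |r - s|) 0) hK
    linarith
  have h2 : ψ |t - s| = ψ 0 + |∫ r in s..t, (K * ψ |r - s| + g |r - s|)| := by
    rw [abs_integral_comp_abs_sub (fun ρ => K * ψ ρ + g ρ) s t,
      intervalIntegral.integral_eq_sub_of_hasDerivAt (fun ρ _ => hψ ρ)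
        (Continuous.intervalIntegrable (by fun_prop) _ _),
      abs_of_nonneg (sub_nonneg.2 (hψ0 _ (abs_nonneg _)))]
    ring
  rw [intervalIntegral.integral_add hi2 hi1] at h1
  linarith [abs_add_le (∫ r in s..t, (K * ψ |r - s| + g |r - s|))
    (∫ r in s..t, K * max (‖z r‖ - ψ |r - s|) 0)]

theorem norm_le_mul_exp {z Z : ℝ → E} {z₀ : E} {K : ℝ} (hK : 0 ≤ K)
    (hs : s ∈ Icc t₀ T) (hz : ContinuousOn z (Icc t₀ T))
    (heq : ∀ t ∈ Icc t₀ T, z t = z₀ + ∫ r in s..t, Z r)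
    (hZ : ∀ᵐ r ∂(volume.restrict (Ioo t₀ T)), ‖Z r‖ ≤ K * ‖z r‖) :
    ∀ t ∈ Icc t₀ T, ‖z t‖ ≤ ‖z₀‖ * Real.exp (K * |t - s|) := by
  refine norm_le_of_integral_eq (g := fun _ => 0) (ψ := fun ρ => ‖z₀‖ * Real.exp (K * ρ))
    hK hs hz continuous_const heq (by simpa using hZ) ?_ ?_ (by simp)
  · intro ρ
    refine (((hasDerivAt_id' ρ).const_mul K).exp.const_mul ‖z₀‖).congr_deriv ?_
    ring
  · intro ρ hρ
    gcongr

theorem norm_le_of_const_source {z Z : ℝ → E} {K c : ℝ} (hK : 0 < K) (hc : 0 ≤ c)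
    (hs : s ∈ Icc t₀ T) (hz : ContinuousOn z (Icc t₀ T))
    (heq : ∀ t ∈ Icc t₀ T, z t = ∫ r in s..t, Z r)
    (hZ : ∀ᵐ r ∂(volume.restrict (Ioo t₀ T)), ‖Z r‖ ≤ K * ‖z r‖ + c) :
    ∀ t ∈ Icc t₀ T, ‖z t‖ ≤ c * ((Real.exp (K * |t - s|) - 1) / K) := by
  refine norm_le_of_integral_eq (g := fun _ => c) (z₀ := (0 : E))
    (ψ := fun ρ => c * ((Real.exp (K * ρ) - 1) / K))
    hK.le hs hz continuous_const (by simpa using heq) hZ ?_ ?_ (by simp)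
  · intro ρ
    refine (((((hasDerivAt_id' ρ).const_mul K).exp.sub_const 1).div_const K).const_mul c).congr_deriv ?_
    field_simp
    ring
  · intro ρ hρ
    gcongr

/-- The bound is the exact solution of ψ' = Kψ + c exp(2Kρ), ψ(0) = 0. This source arises when two
factors each grow like exp(Kρ), as in second-order estimates for the flow. -/
theorem norm_le_of_exp_source {z Z : ℝ → E} {K c : ℝ} (hK : 0 < K) (hc : 0 ≤ c)
    (hs : s ∈ Icc t₀ T) (hz : ContinuousOn z (Icc t₀ T))
    (heq : ∀ t ∈ Icc t₀ T, z t = ∫ r in s..t, Z r)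
    (hZ : ∀ᵐ r ∂(volume.restrict (Ioo t₀ T)),
      ‖Z r‖ ≤ K * ‖z r‖ + c * Real.exp (K * |r - s|) ^ 2) :
    ∀ t ∈ Icc t₀ T,
      ‖z t‖ ≤ c * (Real.exp (K * |t - s|) * ((Real.exp (K * |t - s|) - 1) / K)) := by
  refine norm_le_of_integral_eq (g := fun ρ => c * Real.exp (K * ρ) ^ 2) (z₀ := (0 : E))
    (ψ := fun ρ => c * (Real.exp (K * ρ) * ((Real.exp (K * ρ) - 1) / K)))
    hK.le hs hz (by fun_prop) (by simpa using heq) hZ ?_ ?_ (by simp)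
  · intro ρ
    have h := ((hasDerivAt_id' ρ).const_mul K).exp
    refine ((h.mul ((h.sub_const 1).div_const K)).const_mul c).congr_deriv ?_
    field_simp
  · intro ρ hρ
    rw [mul_zero, Real.exp_zero, sub_self, zero_div, mul_zero, mul_zero]
    have : 1 ≤ Real.exp (K * ρ) := Real.one_le_exp (by positivity)
    have h2 : 0 ≤ Real.exp (K * ρ) - 1 := by linarith
    positivity

/-- Carathéodory conditions on `[t₀, T]`, with a global Lipschitz constant `K` in the state. -/
structure IsCaratheodory (f : ℝ → E → E) (t₀ T K : ℝ) : Prop where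
  meas : ∀ x, AEStronglyMeasurable (fun t => f t x) (volume.restrict (Ioo t₀ T))
  lip : ∀ᵐ t ∂(volume.restrict (Ioo t₀ T)), ∀ x y, ‖f t x - f t y‖ ≤ K * ‖x - y‖
  bdd : ∃ C, ∀ᵐ t ∂(volume.restrict (Ioo t₀ T)), ‖f t 0‖ ≤ C

theorem continuous_of_norm_sub_le {F G : Type*} [SeminormedAddCommGroup F]
    [SeminormedAddCommGroup G] {g : F → G} {K : ℝ}
    (h : ∀ x y, ‖g x - g y‖ ≤ K * ‖x - y‖) : Continuous g := by
  refine (LipschitzWith.of_dist_le' (K := K) fun x y => ?_).continuous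
  rw [dist_eq_norm, dist_eq_norm]
  exact h x y

omit [NormedSpace ℝ E] in
theorem IsCaratheodory.intervalIntegrable {f : ℝ → E → E} {K : ℝ} (hf : IsCaratheodory f t₀ T K)
    {y : ℝ → E} (hy : Continuous y) {t : ℝ} (hs : s ∈ Icc t₀ T) (ht : t ∈ Icc t₀ T) :
    IntervalIntegrable (fun r => f r (y r)) volume s t := by
  have hle : t₀ ≤ T := hs.1.trans hs.2
  suffices h : IntervalIntegrable (fun r => f r (y r)) volume t₀ T by
    refine h.mono_set ?_
    rw [uIcc_of_le hle]
    exact uIcc_subset_Icc_of_mem hs ht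
  rw [intervalIntegrable_iff_integrableOn_Ioo_of_le hle]
  obtain ⟨C, hC⟩ := hf.bdd
  have hdom : IntegrableOn (fun r => C + K * ‖y r‖) (Ioo t₀ T) :=
    (Continuous.integrableOn_Icc (by fun_prop)).mono_set Ioo_subset_Icc_self
  refine hdom.mono' (aestronglyMeasurable_comp_of_continuous hf.meas ?_ hy.stronglyMeasurable) ?_
  · filter_upwards [hf.lip] with r hr using continuous_of_norm_sub_le hr
  · filter_upwards [hf.lip, hC] with r hr hr'
    have h1 := hr (y r) 0
    rw [sub_zero] at h1
    have h2 := norm_add_le (f r (y r) - f r 0) (f r 0)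
    rw [sub_add_cancel] at h2
    linarith

/-- Picard iteration in the unknown y(t) = exp(-l|t-s|) x(t): the ordinary sup norm of y is a
weighted norm of x, in which the map contracts by 1/2 on the whole interval. -/
theorem IsCaratheodory.exists_solution [CompleteSpace E] {f : ℝ → E → E} {K : ℝ}
    (hf : IsCaratheodory f t₀ T K) (hK : 0 ≤ K) (hs : s ∈ Icc t₀ T) (ξ : E) :
    ∃ x : ℝ → E, Continuous x ∧ IntervalIntegrable (fun r => f r (x r)) volume t₀ T ∧
      ∀ t ∈ Icc t₀ T, x t = ξ + ∫ r in s..t, f r (x r) := by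
  have hle : t₀ ≤ T := hs.1.trans hs.2
  have h0 : t₀ ∈ Icc t₀ T := ⟨le_rfl, hle⟩
  have h1 : T ∈ Icc t₀ T := ⟨hle, le_rfl⟩
  set l := 2 * K + 1 with hl
  have hl0 : 0 < l := by positivity
  -- `X y` removes the weight and extends the curve continuously to ℝ.
  let X : C(Icc t₀ T, E) → ℝ → E := fun y r => Real.exp (l * |r - s|) • y (projIcc t₀ T hle r)
  have hX : ∀ y, Continuous (X y) := fun y => by
    have : Continuous fun r => y (projIcc t₀ T hle r) := y.continuous.comp continuous_projIcc
    exact Continuous.smul (by fun_prop) this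
  have hprim : ∀ y, ContinuousOn (fun t => ∫ r in s..t, f r (X y r)) (Icc t₀ T) := fun y => by
    have := intervalIntegral.continuousOn_primitive_interval' (a := s)
      (hf.intervalIntegrable (hX y) h0 h1) (by rwa [uIcc_of_le hle])
    rwa [uIcc_of_le hle] at this
  let Q : C(Icc t₀ T, E) → C(Icc t₀ T, E) := fun y =>
    ⟨fun t => Real.exp (-(l * |(t : ℝ) - s|)) • (ξ + ∫ r in s..(t : ℝ), f r (X y r)), by
      have := continuousOn_iff_continuous_domRestrict.1 (hprim y)
      exact Continuous.smul (by fun_prop) (continuous_const.add this)⟩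
  have hQ : ContractingWith (2⁻¹ : NNReal) Q := by
    refine ⟨by rw [← NNReal.coe_lt_coe]; push_cast; norm_num, LipschitzWith.of_dist_le_mul fun y w => ?_⟩
    rw [ContinuousMap.dist_le (by positivity)]
    intro t
    rw [dist_eq_norm]
    simp only [Q, ContinuousMap.coe_mk, ← smul_sub, add_sub_add_left_eq_sub]
    rw [← intervalIntegral.integral_sub (hf.intervalIntegrable (hX y) hs t.2)
      (hf.intervalIntegrable (hX w) hs t.2), norm_smul, Real.norm_of_nonneg (by positivity)]
    have hb : ‖∫ r in s..(t : ℝ), (f r (X y r) - f r (X w r))‖ ≤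
        |∫ r in s..(t : ℝ), K * dist y w * Real.exp (l * |r - s|)| := by
      refine intervalIntegral.norm_integral_le_abs_of_norm_le ?_
        (Continuous.intervalIntegrable (by fun_prop) _ _)
      filter_upwards [ae_restrict_uIoc_of_Ioo hs t.2 hf.lip] with r hr
      refine (hr _ _).trans ?_
      simp only [X]
      rw [← smul_sub, norm_smul, Real.norm_of_nonneg (by positivity), mul_assoc,
        mul_comm (dist y w)]
      have := ContinuousMap.dist_apply_le_dist (f := y) (g := w) (projIcc t₀ T hle r)
      rw [dist_eq_norm] at this
      gcongr
    rw [intervalIntegral.integral_const_mul (K * dist y w), abs_mul (K * dist y w),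
      abs_of_nonneg (by positivity : 0 ≤ K * dist y w)] at hb
    have hb' := hb.trans (mul_le_mul_of_nonneg_left (abs_integral_exp_abs_sub_le hl0 s t)
      (by positivity : 0 ≤ K * dist y w))
    calc Real.exp (-(l * |(t : ℝ) - s|)) * ‖∫ r in s..(t : ℝ), (f r (X y r) - f r (X w r))‖
        ≤ Real.exp (-(l * |(t : ℝ) - s|)) *
          (K * dist y w * (Real.exp (l * |(t : ℝ) - s|) / l)) := by gcongr
      _ = (K / l * dist y w) *
          (Real.exp (-(l * |(t : ℝ) - s|)) * Real.exp (l * |(t : ℝ) - s|)) := by ring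
      _ = K / l * dist y w := by rw [← Real.exp_add]; simp
      _ ≤ 2⁻¹ * dist y w := by
          refine mul_le_mul_of_nonneg_right ?_ dist_nonneg
          rw [div_le_iff₀ hl0]
          linarith
      _ = _ := rfl
  obtain ⟨y, hy⟩ : ∃ y, Q y = y := ⟨_, hQ.fixedPoint_isFixedPt⟩
  refine ⟨X y, hX y, hf.intervalIntegrable (hX y) h0 h1, fun t ht => ?_⟩
  have hyt := DFunLike.congr_fun hy ⟨t, ht⟩
  simp only [Q, ContinuousMap.coe_mk] at hyt
  change Real.exp (l * |t - s|) • y (projIcc t₀ T hle t) = _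
  rw [projIcc_of_mem hle ht, ← hyt, smul_smul, ← Real.exp_add, add_neg_cancel, Real.exp_zero,
    one_smul]

end Caratheodory

/-! ### The flow: uniqueness, composition, regularity in the initial state. -/

section Flow

theorem ContinuousLinearMap.aestronglyMeasurable_of_apply {α F : Type*} [MeasurableSpace α]
    {μ : Measure α} [NormedAddCommGroup F] [NormedSpace ℝ F] {n : ℕ}
    {A : α → Vec n →L[ℝ] F} (h : ∀ v, AEStronglyMeasurable (fun t => A t v) μ) :
    AEStronglyMeasurable A μ := by
  have hA : A = fun t => ∑ i, ContinuousLinearMap.smulRightL ℝ (Vec n) F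
      (EuclideanSpace.proj i) (A t (EuclideanSpace.single i 1)) := by
    ext t v
    simp only [_root_.sum_apply, ContinuousLinearMap.smulRightL_apply_apply]
    conv_lhs => rw [← (EuclideanSpace.basisFun (Fin n) ℝ).sum_repr v]
    simp
  rw [hA]
  refine Finset.aestronglyMeasurable_fun_sum _ fun i _ => ?_
  exact (ContinuousLinearMap.continuous _).comp_aestronglyMeasurable (h _)

/-- Directional derivatives are limits of difference quotients, and in finite dimension they
determine the measurability of the derivative. -/
theorem aestronglyMeasurable_fderiv_of_param {α F : Type*} [MeasurableSpace α]
    {μ : Measure α} [NormedAddCommGroup F] [NormedSpace ℝ F] {n : ℕ} {f : α → Vec n → F}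
    (hf : ∀ x, AEStronglyMeasurable (fun t => f t x) μ)
    (hd : ∀ᵐ t ∂μ, Differentiable ℝ (f t)) (x : Vec n) :
    AEStronglyMeasurable (fun t => fderiv ℝ (f t) x) μ := by
  refine ContinuousLinearMap.aestronglyMeasurable_of_apply fun v => ?_
  refine aestronglyMeasurable_of_tendsto_ae atTop
    (f := fun (m : ℕ) t => (m : ℝ) • (f t (x + (m : ℝ)⁻¹ • v) - f t x))
    (fun m => ((hf _).sub (hf _)).const_smul _) ?_
  filter_upwards [hd] with t ht
  exact ((ht x).hasFDerivAt.lim_real v).comp tendsto_natCast_atTop_atTop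

variable {d k : ℕ} {t₀ T s : ℝ} {f g : ℝ → Vec d → Vec d} {ξ η : Vec d} {x y : ℝ → Vec d} {K : ℝ}

theorem IsSolutionOn.intervalIntegrable (hx : IsSolutionOn f t₀ T s ξ x) {a b : ℝ}
    (ha : a ∈ Icc t₀ T) (hb : b ∈ Icc t₀ T) :
    IntervalIntegrable (fun r => f r (x r)) volume a b := by
  refine hx.2.1.mono_set ?_
  rw [uIcc_of_le (ha.1.trans ha.2)]
  exact uIcc_subset_Icc_of_mem ha hb

theorem IsSolutionOn.sub_eq (hx : IsSolutionOn f t₀ T s ξ x) (hy : IsSolutionOn g t₀ T s η y)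
    (hs : s ∈ Icc t₀ T) {t : ℝ} (ht : t ∈ Icc t₀ T) :
    x t - y t = (ξ - η) + ∫ r in s..t, (f r (x r) - g r (y r)) := by
  rw [intervalIntegral.integral_sub (hx.intervalIntegrable hs ht) (hy.intervalIntegrable hs ht),
    hx.2.2 t ht, hy.2.2 t ht]
  abel

theorem IsSolutionOn.norm_sub_le (hf : IsCaratheodory f t₀ T K) (hK : 0 ≤ K)
    (hs : s ∈ Icc t₀ T) (hx : IsSolutionOn f t₀ T s ξ x) (hy : IsSolutionOn f t₀ T s η y)
    {t : ℝ} (ht : t ∈ Icc t₀ T) :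
    ‖x t - y t‖ ≤ ‖ξ - η‖ * Real.exp (K * |t - s|) := by
  refine norm_le_mul_exp (z := fun t => x t - y t) hK hs (hx.1.sub hy.1)
    (fun t ht => hx.sub_eq hy hs ht) ?_ t ht
  filter_upwards [hf.lip] with r hr using hr _ _

theorem IsSolutionOn.eqOn (hf : IsCaratheodory f t₀ T K) (hK : 0 ≤ K)
    (hs : s ∈ Icc t₀ T) (hx : IsSolutionOn f t₀ T s ξ x) (hy : IsSolutionOn f t₀ T s ξ y) :
    EqOn x y (Icc t₀ T) := by
  intro t ht
  have := hx.norm_sub_le hf hK hs hy ht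
  rw [sub_self, norm_zero, zero_mul, norm_le_zero_iff] at this
  exact sub_eq_zero.1 this

theorem IsCaratheodory.hasUniqueSolutionOn (hf : IsCaratheodory f t₀ T K) (hK : 0 ≤ K)
    (hs : s ∈ Icc t₀ T) (ξ : Vec d) : HasUniqueSolutionOn f t₀ T s ξ := by
  obtain ⟨x, hx, hi, he⟩ := hf.exists_solution hK hs ξ
  have hsol : IsSolutionOn f t₀ T s ξ x := ⟨hx.continuousOn, hi, he⟩
  exact ⟨x, hsol, fun y hy => hy.eqOn hf hK hs hsol⟩

theorem IsCaratheodory.isSolutionOn_solution (hf : IsCaratheodory f t₀ T K) (hK : 0 ≤ K)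
    (hs : s ∈ Icc t₀ T) (ξ : Vec d) : IsSolutionOn f t₀ T s ξ (solution f t₀ T s ξ) := by
  obtain ⟨x, hx, -⟩ := hf.hasUniqueSolutionOn hK hs ξ
  exact Classical.epsilon_spec (p := IsSolutionOn f t₀ T s ξ) ⟨x, hx⟩

theorem IsSolutionOn.restart (hs : s ∈ Icc t₀ T) (hx : IsSolutionOn f t₀ T s ξ x) {s' : ℝ}
    (hs' : s' ∈ Icc t₀ T) : IsSolutionOn f t₀ T s' (x s') x := by
  refine ⟨hx.1, hx.2.1, fun t ht => ?_⟩
  rw [hx.2.2 t ht, hx.2.2 s' hs', ← intervalIntegral.integral_add_adjacent_intervals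
    (hx.intervalIntegrable hs hs') (hx.intervalIntegrable hs' ht)]
  abel

section
variable {N : ℝ → Vec d → Vec d} {Λ : ℝ} (hN : IsCaratheodory N t₀ T Λ) (hΛ : 0 ≤ Λ)
include hN hΛ

theorem norm_flow_sub_le (hs : s ∈ Icc t₀ T) {t : ℝ} (ht : t ∈ Icc t₀ T) (ξ η : Vec d) :
    ‖flow N t₀ T s t ξ - flow N t₀ T s t η‖ ≤ ‖ξ - η‖ * Real.exp (Λ * |t - s|) :=
  (hN.isSolutionOn_solution hΛ hs ξ).norm_sub_le hN hΛ hs (hN.isSolutionOn_solution hΛ hs η) ht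

theorem flow_flow (hs : s ∈ Icc t₀ T) {s' t : ℝ} (hs' : s' ∈ Icc t₀ T) (ht : t ∈ Icc t₀ T)
    (ξ : Vec d) : flow N t₀ T s' t (flow N t₀ T s s' ξ) = flow N t₀ T s t ξ :=
  (hN.isSolutionOn_solution hΛ hs' _).eqOn hN hΛ hs'
    ((hN.isSolutionOn_solution hΛ hs ξ).restart hs hs') ht

theorem flow_self (hs : s ∈ Icc t₀ T) (ξ : Vec d) : flow N t₀ T s s ξ = ξ := by
  have h := (hN.isSolutionOn_solution hΛ hs ξ).2.2 s hs
  rwa [intervalIntegral.integral_same, add_zero] at h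

/-- Joint continuity in initial time and state, needed for the measurability of t ↦ DΦ_{t,τ}.
Clamping the time to [t₀, T] gives a map continuous everywhere. -/
theorem continuous_flow_projIcc (hle : t₀ ≤ T) {τ : ℝ} (hτ : τ ∈ Icc t₀ T) :
    Continuous (Function.uncurry fun t : ℝ => flow N t₀ T (projIcc t₀ T hle t) τ) := by
  rw [continuous_iff_continuousAt]
  rintro ⟨t', ξ'⟩
  set p : ℝ → Icc t₀ T := projIcc t₀ T hle with hp
  have hbound : ∀ q : ℝ × Vec d, dist (flow N t₀ T (p q.1) τ q.2) (flow N t₀ T (p t') τ ξ') ≤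
      ‖q.2 - flow N t₀ T (p t') (p q.1) ξ'‖ * Real.exp (Λ * |τ - p q.1|) := fun q => by
    -- Writing Φ_{t',τ} = Φ_{t,τ} ∘ Φ_{t',t} turns a change of initial time into a change of initial
    -- state.
    rw [dist_eq_norm, ← flow_flow hN hΛ (p t').2 (p q.1).2 hτ ξ']
    exact norm_flow_sub_le hN hΛ (p q.1).2 hτ _ _
  have hpc : Continuous p := continuous_projIcc
  have hc : Continuous fun t => flow N t₀ T (p t') (p t) ξ' := by
    have := continuousOn_iff_continuous_domRestrict.1
      (hN.isSolutionOn_solution hΛ (p t').2 ξ').1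
    exact this.comp hpc
  have hlim : Tendsto (fun q : ℝ × Vec d =>
      ‖q.2 - flow N t₀ T (p t') (p q.1) ξ'‖ * Real.exp (Λ * |τ - p q.1|)) (𝓝 (t', ξ')) (𝓝 0) := by
    have hcont : Continuous fun q : ℝ × Vec d =>
        ‖q.2 - flow N t₀ T (p t') (p q.1) ξ'‖ * Real.exp (Λ * |τ - p q.1|) := by
      have := hc.comp (continuous_fst (X := ℝ) (Y := Vec d))
      refine (continuous_snd.sub this).norm.mul ?_
      fun_prop
    have := hcont.tendsto (t', ξ')
    simpa [flow_self hN hΛ (p t').2] using this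
  refine tendsto_iff_dist_tendsto_zero.2 ?_
  exact squeeze_zero (fun _ => dist_nonneg) hbound hlim

end

/-- The standing assumptions on the drift. -/
structure IsSmoothDrift (N : ℝ → Vec d → Vec d) (t₀ T Λ₁ Λ₂ : ℝ) : Prop where
  memLp : ∀ x, MemLp (fun t => N t x) ⊤ ((volume : Measure ℝ).restrict (Ioo t₀ T))
  contDiff : ∀ t ∈ Icc t₀ T, ContDiff ℝ 2 (N t)
  norm_fderiv_le : ∀ t ∈ Icc t₀ T, ∀ w, ‖fderiv ℝ (N t) w‖ ≤ Λ₁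
  norm_fderiv_fderiv_le : ∀ t ∈ Icc t₀ T, ∀ w, ‖fderiv ℝ (fderiv ℝ (N t)) w‖ ≤ Λ₂

theorem MeasureTheory.MemLp.exists_ae_norm_le {α F : Type*} [MeasurableSpace α] {μ : Measure α}
    [NormedAddCommGroup F] {h : α → F} (hh : MemLp h ⊤ μ) :
    ∀ᵐ t ∂μ, ‖h t‖ ≤ (eLpNorm h ⊤ μ).toReal := by
  have hfin := hh.2
  rw [eLpNorm_exponent_top] at hfin ⊢
  filter_upwards [ae_le_eLpNormEssSup (f := h) (μ := μ)] with t ht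
  rw [← toReal_enorm]
  exact ENNReal.toReal_mono hfin.ne ht

theorem ae_Ioo_of_forall_mem_Icc {p : ℝ → Prop} (h : ∀ t ∈ Icc t₀ T, p t) :
    ∀ᵐ t ∂(volume.restrict (Ioo t₀ T)), p t :=
  ae_restrict_of_forall_mem measurableSet_Ioo fun t ht => h t (Ioo_subset_Icc_self ht)

/-! ### Differentiability of the flow and Lipschitz dependence of its derivative. -/

namespace IsSmoothDrift

variable {N : ℝ → Vec d → Vec d} {Λ₁ Λ₂ : ℝ} (hN : IsSmoothDrift N t₀ T Λ₁ Λ₂)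
include hN

theorem norm_sub_le {t : ℝ} (ht : t ∈ Icc t₀ T) (a b : Vec d) :
    ‖N t a - N t b‖ ≤ Λ₁ * ‖a - b‖ :=
  convex_univ.norm_image_sub_le_of_norm_fderiv_le
    (fun w _ => ((hN.contDiff t ht).differentiable (by norm_num)) w)
    (fun w _ => hN.norm_fderiv_le t ht w) (mem_univ b) (mem_univ a)

theorem norm_fderiv_sub_le {t : ℝ} (ht : t ∈ Icc t₀ T) (a b : Vec d) :
    ‖fderiv ℝ (N t) a - fderiv ℝ (N t) b‖ ≤ Λ₂ * ‖a - b‖ :=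
  convex_univ.norm_image_sub_le_of_norm_fderiv_le
    (fun w _ => (((hN.contDiff t ht).fderiv_right (m := 1) (by norm_num)).differentiable
      (by norm_num)) w)
    (fun w _ => hN.norm_fderiv_fderiv_le t ht w) (mem_univ b) (mem_univ a)

/-- The sharp factor 1/2 is dropped: only the quadratic order matters for differentiability of the
flow. -/
theorem norm_taylor_le (hΛ₂ : 0 ≤ Λ₂) {t : ℝ} (ht : t ∈ Icc t₀ T) (a b : Vec d) :
    ‖N t b - N t a - fderiv ℝ (N t) a (b - a)‖ ≤ Λ₂ * ‖b - a‖ ^ 2 := by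
  have hd := (hN.contDiff t ht).differentiable (by norm_num : (2 : WithTop ℕ∞) ≠ 0)
  have := (convex_segment a b).norm_image_sub_le_of_norm_hasFDerivWithin_le' (𝕜 := ℝ)
    (f := N t) (f' := fderiv ℝ (N t)) (φ := fderiv ℝ (N t) a) (C := Λ₂ * ‖b - a‖)
    (fun w _ => (hd w).hasFDerivAt.hasFDerivWithinAt) (fun w hw => ?_)
    (left_mem_segment ℝ a b) (right_mem_segment ℝ a b)
  · rwa [mul_assoc, ← sq] at this
  · refine (hN.norm_fderiv_sub_le ht w a).trans ?_
    refine mul_le_mul_of_nonneg_left ?_ hΛ₂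
    obtain ⟨θ, hθ, rfl⟩ := (segment_eq_image' ℝ a b ▸ hw : w ∈ _)
    rw [add_sub_cancel_left, norm_smul, Real.norm_of_nonneg hθ.1]
    exact mul_le_of_le_one_left (norm_nonneg _) hθ.2

theorem isCaratheodory : IsCaratheodory N t₀ T Λ₁ where
  meas x := (hN.memLp x).1
  lip := ae_Ioo_of_forall_mem_Icc fun _ ht => hN.norm_sub_le ht
  bdd := ⟨_, (hN.memLp 0).exists_ae_norm_le⟩

theorem isCaratheodory_variational {y : ℝ → Vec d} (hy : Continuous y) :
    IsCaratheodory (fun t (W : Vec d →L[ℝ] Vec d) => (fderiv ℝ (N t) (y t)).comp W)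
      t₀ T Λ₁ where
  meas W := by
    have h1 := aestronglyMeasurable_fderiv_of_param (fun x => (hN.memLp x).1)
      (ae_Ioo_of_forall_mem_Icc fun t ht => (hN.contDiff t ht).differentiable (by norm_num))
    have h2 := aestronglyMeasurable_comp_of_continuous h1
      (ae_Ioo_of_forall_mem_Icc fun t ht => (hN.contDiff t ht).continuous_fderiv (by norm_num))
      hy.stronglyMeasurable
    exact (((ContinuousLinearMap.compL ℝ (Vec d) (Vec d) (Vec d)).flip W).continuous).comp_aestronglyMeasurable h2
  lip := ae_Ioo_of_forall_mem_Icc fun t ht V W => by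
    rw [← ContinuousLinearMap.comp_sub]
    exact (ContinuousLinearMap.opNorm_comp_le _ _).trans
      (mul_le_mul_of_nonneg_right (hN.norm_fderiv_le t ht _) (norm_nonneg _))
  bdd := ⟨0, by simp⟩

/-- `W` solves the variational equation along the trajectory of `x`. The remainder Φ(x+h) - Φ(x) -
Wh obeys the same linear equation up to a Taylor error at most Λ₂‖h‖² exp(2Λ₁|r-s|), hence is
O(‖h‖²). -/
theorem exists_hasFDerivAt_flow (hΛ₁ : 0 < Λ₁) (hΛ₂ : 0 < Λ₂) (hs : s ∈ Icc t₀ T) (x : Vec d) :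
    ∃ W : ℝ → Vec d →L[ℝ] Vec d, Continuous W ∧
      IntervalIntegrable (fun r => (fderiv ℝ (N r) (flow N t₀ T s r x)).comp (W r)) volume t₀ T ∧
      (∀ t ∈ Icc t₀ T, W t = ContinuousLinearMap.id ℝ (Vec d) +
        ∫ r in s..t, (fderiv ℝ (N r) (flow N t₀ T s r x)).comp (W r)) ∧
      ∀ t ∈ Icc t₀ T, HasFDerivAt (flow N t₀ T s t) (W t) x := by
  have hle : t₀ ≤ T := hs.1.trans hs.2
  have hC := hN.isCaratheodory
  have hsol := fun ξ => hC.isSolutionOn_solution hΛ₁.le hs ξ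
  let y : ℝ → Vec d := fun r => flow N t₀ T s (projIcc t₀ T hle r) x
  have hy : Continuous y :=
    (continuousOn_iff_continuous_domRestrict.1 (hsol x).1).comp continuous_projIcc
  have hyx : ∀ r ∈ Icc t₀ T, y r = flow N t₀ T s r x := fun r hr => by
    simp only [y, projIcc_of_mem hle hr]
  obtain ⟨W, hWc, hWi, hWe⟩ := (hN.isCaratheodory_variational hy).exists_solution hΛ₁.le hs
    (ContinuousLinearMap.id ℝ (Vec d))
  have hWi' : IntervalIntegrable
      (fun r => (fderiv ℝ (N r) (flow N t₀ T s r x)).comp (W r)) volume t₀ T := by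
    refine hWi.congr fun r hr => ?_
    rw [uIoc_of_le hle] at hr
    simp only [hyx r (Ioc_subset_Icc_self hr)]
  have hWe' : ∀ t ∈ Icc t₀ T, W t = ContinuousLinearMap.id ℝ (Vec d) +
        ∫ r in s..t, (fderiv ℝ (N r) (flow N t₀ T s r x)).comp (W r) := fun t ht => by
    rw [hWe t ht]
    congr 1
    refine intervalIntegral.integral_congr fun r hr => ?_
    simp only [hyx r (uIcc_subset_Icc_of_mem hs ht hr)]
  refine ⟨W, hWc, hWi', hWe', fun t ht => ?_⟩
  have hWi'' : ∀ t ∈ Icc t₀ T, IntervalIntegrable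
      (fun r => (fderiv ℝ (N r) (flow N t₀ T s r x)).comp (W r)) volume s t := fun t ht => by
    refine hWi'.mono_set ?_
    rw [uIcc_of_le hle]
    exact uIcc_subset_Icc_of_mem hs ht
  have key : ∀ h : Vec d, ‖flow N t₀ T s t (x + h) - flow N t₀ T s t x - W t h‖ ≤
      Λ₂ * ‖h‖ ^ 2 * (Real.exp (Λ₁ * |t - s|) * ((Real.exp (Λ₁ * |t - s|) - 1) / Λ₁)) := by
    intro h
    refine norm_le_of_exp_source
      (z := fun t => flow N t₀ T s t (x + h) - flow N t₀ T s t x - W t h)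
      (Z := fun r => N r (flow N t₀ T s r (x + h)) - N r (flow N t₀ T s r x) -
        fderiv ℝ (N r) (flow N t₀ T s r x) (W r h))
      hΛ₁ (by positivity) hs (((hsol _).1.sub (hsol _).1).sub
        (by fun_prop)) (fun t ht => ?_) (ae_Ioo_of_forall_mem_Icc fun r hr => ?_) t ht
    · have hWh : W t h = h + ∫ r in s..t, fderiv ℝ (N r) (flow N t₀ T s r x) (W r h) := by
        have h1 := congrArg (fun A => ContinuousLinearMap.apply ℝ (Vec d) h A) (hWe' t ht)
        simp only [map_add] at h1
        rw [← ContinuousLinearMap.intervalIntegral_comp_comm _ (hWi'' t ht)] at h1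
        simpa using h1
      have hi : IntervalIntegrable (fun r => fderiv ℝ (N r) (flow N t₀ T s r x) (W r h))
          volume s t :=
        ⟨(ContinuousLinearMap.apply ℝ (Vec d) h).integrable_comp (hWi'' t ht).1,
          (ContinuousLinearMap.apply ℝ (Vec d) h).integrable_comp (hWi'' t ht).2⟩
      have h2 := (hsol (x + h)).sub_eq (hsol x) hs ht
      change solution N t₀ T s (x + h) t - solution N t₀ T s x t - W t h = _
      rw [h2, hWh]
      rw [intervalIntegral.integral_sub _ hi]
      · simp only [flow]
        abel
      · exact ((hsol (x + h)).intervalIntegrable hs ht).sub ((hsol x).intervalIntegrable hs ht)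
    · set a := flow N t₀ T s r x
      set b := flow N t₀ T s r (x + h)
      have hab : ‖b - a‖ ≤ ‖h‖ * Real.exp (Λ₁ * |r - s|) := by
        simpa using norm_flow_sub_le hC hΛ₁.le hs hr (x + h) x
      have hsplit : N r b - N r a - fderiv ℝ (N r) a (W r h) =
          fderiv ℝ (N r) a (b - a - W r h) + (N r b - N r a - fderiv ℝ (N r) a (b - a)) := by
        rw [map_sub _ (b - a)]
        abel
      rw [hsplit]
      refine (norm_add_le _ _).trans (add_le_add ?_ ?_)
      · exact ((fderiv ℝ (N r) a).le_opNorm _).trans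
          (mul_le_mul_of_nonneg_right (hN.norm_fderiv_le r hr a) (norm_nonneg _))
      · refine (hN.norm_taylor_le hΛ₂.le hr a b).trans ?_
        rw [mul_assoc, ← mul_pow]
        gcongr
  rw [hasFDerivAt_iff_isLittleO_nhds_zero]
  refine Asymptotics.IsBigO.trans_isLittleO (g := fun h : Vec d => ‖h‖ ^ 2) ?_
    (Asymptotics.isLittleO_norm_pow_id (by norm_num))
  refine Asymptotics.IsBigO.of_bound
    (Λ₂ * (Real.exp (Λ₁ * |t - s|) * ((Real.exp (Λ₁ * |t - s|) - 1) / Λ₁)))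
    (Eventually.of_forall fun h => (key h).trans (le_of_eq ?_))
  rw [Real.norm_of_nonneg (by positivity)]
  ring

theorem differentiable_flow (hΛ₁ : 0 < Λ₁) (hΛ₂ : 0 < Λ₂) (hs : s ∈ Icc t₀ T) {t : ℝ}
    (ht : t ∈ Icc t₀ T) : Differentiable ℝ (flow N t₀ T s t) := fun x => by
  obtain ⟨W, -, -, -, hW⟩ := hN.exists_hasFDerivAt_flow hΛ₁ hΛ₂ hs x
  exact (hW t ht).differentiableAt

theorem norm_fderiv_flow_le (hΛ₁ : 0 < Λ₁) (hs : s ∈ Icc t₀ T) {t : ℝ}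
    (ht : t ∈ Icc t₀ T) (x : Vec d) :
    ‖fderiv ℝ (flow N t₀ T s t) x‖ ≤ Real.exp (Λ₁ * |t - s|) := by
  have hl : LipschitzWith (Real.toNNReal (Real.exp (Λ₁ * |t - s|))) (flow N t₀ T s t) :=
    LipschitzWith.of_dist_le' fun a b => by
      rw [dist_eq_norm, dist_eq_norm, mul_comm]
      exact norm_flow_sub_le hN.isCaratheodory hΛ₁.le hs ht a b
  have := norm_fderiv_le_of_lipschitz ℝ hl (x₀ := x)
  rwa [Real.coe_toNNReal _ (Real.exp_nonneg _)] at this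

theorem norm_fderiv_flow_sub_le (hΛ₁ : 0 < Λ₁) (hΛ₂ : 0 < Λ₂) (hs : s ∈ Icc t₀ T) {t : ℝ}
    (ht : t ∈ Icc t₀ T) (x y : Vec d) :
    ‖fderiv ℝ (flow N t₀ T s t) x - fderiv ℝ (flow N t₀ T s t) y‖ ≤
      Λ₂ * ‖x - y‖ * (Real.exp (Λ₁ * |t - s|) * ((Real.exp (Λ₁ * |t - s|) - 1) / Λ₁)) := by
  obtain ⟨V, hVc, hVi, hVe, hV⟩ := hN.exists_hasFDerivAt_flow hΛ₁ hΛ₂ hs x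
  obtain ⟨W, hWc, hWi, hWe, hW⟩ := hN.exists_hasFDerivAt_flow hΛ₁ hΛ₂ hs y
  rw [(hV t ht).fderiv, (hW t ht).fderiv]
  refine norm_le_of_exp_source (z := fun t => V t - W t)
    (Z := fun r => (fderiv ℝ (N r) (flow N t₀ T s r x)).comp (V r) -
      (fderiv ℝ (N r) (flow N t₀ T s r y)).comp (W r))
    hΛ₁ (by positivity) hs (by fun_prop) (fun t ht => ?_) (ae_Ioo_of_forall_mem_Icc fun r hr => ?_) t ht
  · have hsub : uIcc s t ⊆ uIcc t₀ T := by
      rw [uIcc_of_le (hs.1.trans hs.2)]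
      exact uIcc_subset_Icc_of_mem hs ht
    rw [intervalIntegral.integral_sub (hVi.mono_set hsub) (hWi.mono_set hsub), hVe t ht, hWe t ht]
    abel
  · set a := flow N t₀ T s r x
    set b := flow N t₀ T s r y
    have hab : ‖a - b‖ ≤ ‖x - y‖ * Real.exp (Λ₁ * |r - s|) :=
      norm_flow_sub_le hN.isCaratheodory hΛ₁.le hs hr x y
    have hWn : ‖W r‖ ≤ Real.exp (Λ₁ * |r - s|) := by
      rw [← (hW r hr).fderiv]
      exact hN.norm_fderiv_flow_le hΛ₁ hs hr y
    -- The second summand is the source: one exponential comes from ‖a - b‖, the other from ‖W r‖.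
    have hsplit : (fderiv ℝ (N r) a).comp (V r) - (fderiv ℝ (N r) b).comp (W r) =
        (fderiv ℝ (N r) a).comp (V r - W r) +
          (fderiv ℝ (N r) a - fderiv ℝ (N r) b).comp (W r) := by
      rw [ContinuousLinearMap.comp_sub, ContinuousLinearMap.sub_comp]
      abel
    rw [hsplit]
    refine (norm_add_le _ _).trans (add_le_add ?_ ?_)
    · exact (ContinuousLinearMap.opNorm_comp_le _ _).trans
        (mul_le_mul_of_nonneg_right (hN.norm_fderiv_le r hr a) (norm_nonneg _))
    · refine (ContinuousLinearMap.opNorm_comp_le _ _).trans ?_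
      calc _ ≤ (Λ₂ * (‖x - y‖ * Real.exp (Λ₁ * |r - s|))) * Real.exp (Λ₁ * |r - s|) := by
            gcongr
            exact (hN.norm_fderiv_sub_le hr a b).trans (by gcongr)
        _ = _ := by ring

end IsSmoothDrift

end Flow

/-! ### Trajectories and Gramians. -/

section Gramian

variable {d k : ℕ} {t₀ T : ℝ}

theorem Control.ae_norm_le (u : Control k t₀ T) :
    ∀ᵐ t ∂(volume.restrict (Ioo t₀ T)), ‖u t‖ ≤ ‖u‖ := by
  rw [Lp.norm_def]
  exact (Lp.memLp u).exists_ae_norm_le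

/-- The standing assumptions on the input matrix. -/
structure IsSmoothInput (B : ℝ → Vec d → (Vec k →L[ℝ] Vec d)) (t₀ T L : ℝ) : Prop where
  memLp : MemLp (fun p : ℝ × Vec d => B p.1 p.2) ⊤
    (((volume : Measure ℝ).restrict (Ioo t₀ T)).prod (volume : Measure (Vec d)))
  contDiff : ∀ t ∈ Icc t₀ T, ContDiff ℝ 1 (B t)
  norm_fderiv_le : ∀ t ∈ Icc t₀ T, ∀ w : Vec d, ‖fderiv ℝ (B t) w‖ ≤ L

theorem inputSupNorm_nonneg (B : ℝ → Vec d → (Vec k →L[ℝ] Vec d)) :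
    0 ≤ inputSupNorm t₀ T B := ENNReal.toReal_nonneg

theorem IsSmoothDrift.aestronglyMeasurable_fderiv_flow {N : ℝ → Vec d → Vec d} {Λ₁ Λ₂ : ℝ}
    (hN : IsSmoothDrift N t₀ T Λ₁ Λ₂) (hΛ₁ : 0 < Λ₁) {τ : ℝ} (hτ : τ ∈ Icc t₀ T)
    {X : ℝ → Vec d} (hX : Continuous X) :
    AEStronglyMeasurable (fun t => fderiv ℝ (flow N t₀ T t τ) (X t))
      (volume.restrict (Ioo t₀ T)) := by
  have htT : t₀ ≤ T := hτ.1.trans hτ.2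
  have h0 : Measurable fun p : ℝ × Vec d =>
      fderiv ℝ (flow N t₀ T (projIcc t₀ T htT p.1) τ) p.2 :=
    measurable_fderiv_with_param ℝ (f := fun t : ℝ => flow N t₀ T (projIcc t₀ T htT t) τ)
      (continuous_flow_projIcc hN.isCaratheodory hΛ₁.le htT hτ)
  have h1 : Measurable fun t : ℝ => (t, X t) := measurable_id.prodMk hX.measurable
  have h2 : AEStronglyMeasurable
      (fun t : ℝ => fderiv ℝ (flow N t₀ T (projIcc t₀ T htT t) τ) (X t))
      (volume.restrict (Ioo t₀ T)) := (h0.comp h1).aestronglyMeasurable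
  refine h2.congr (ae_Ioo_of_forall_mem_Icc fun t ht => ?_)
  simp only [projIcc_of_mem htT ht]

namespace IsSmoothInput

variable {B : ℝ → Vec d → (Vec k →L[ℝ] Vec d)} {L : ℝ} (hB : IsSmoothInput B t₀ T L)
include hB

theorem norm_sub_le {t : ℝ} (ht : t ∈ Icc t₀ T) (a b : Vec d) :
    ‖B t a - B t b‖ ≤ L * ‖a - b‖ :=
  convex_univ.norm_image_sub_le_of_norm_fderiv_le
    (fun w _ => ((hB.contDiff t ht).differentiable (by norm_num)) w)
    (fun w _ => hB.norm_fderiv_le t ht w) (mem_univ b) (mem_univ a)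

/-- Measurability on the product gives measurable sections only for almost every state; such states
are dense, and continuity of `B t` reaches the rest. -/
theorem aestronglyMeasurable_left (x : Vec d) :
    AEStronglyMeasurable (fun t => B t x) (volume.restrict (Ioo t₀ T)) := by
  have hdense := Measure.dense_of_ae (hB.memLp.1.prod_swap.prodMk_left)
  obtain ⟨y, hy, hyx⟩ := mem_closure_iff_seq_limit.1 (hdense x)
  refine aestronglyMeasurable_of_tendsto_ae atTop (f := fun n t => B t (y n)) (fun n => hy n)
    (ae_Ioo_of_forall_mem_Icc fun t ht => ?_)
  exact ((hB.contDiff t ht).continuous.tendsto x).comp hyx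

/-- Outside one null set of times the bound holds for almost every state, hence for all by density
and continuity. Having the null set independent of `x` allows a trajectory to be substituted. -/
theorem ae_norm_le : ∀ᵐ t ∂(volume.restrict (Ioo t₀ T)), ∀ x, ‖B t x‖ ≤ inputSupNorm t₀ T B := by
  filter_upwards [Measure.ae_ae_of_ae_prod hB.memLp.exists_ae_norm_le,
    ae_Ioo_of_forall_mem_Icc fun t ht => (hB.contDiff t ht).continuous] with t ht hc x
  have hclosed : IsClosed {x | ‖B t x‖ ≤ inputSupNorm t₀ T B} :=
    isClosed_le hc.norm continuous_const
  exact hclosed.closure_subset (Measure.dense_of_ae ht x)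

variable {N : ℝ → Vec d → Vec d} {Λ₁ Λ₂ : ℝ} (hN : IsSmoothDrift N t₀ T Λ₁ Λ₂)
include hN

theorem isCaratheodory_controlledField (u : Control k t₀ T) :
    IsCaratheodory (controlledField N B u) t₀ T (Λ₁ + L * ‖u‖) where
  meas x := (hN.memLp x).1.add
    (isBoundedBilinearMap_apply.continuous.comp_aestronglyMeasurable
      ((hB.aestronglyMeasurable_left x).prodMk (Lp.aestronglyMeasurable u)))
  lip := by
    filter_upwards [ae_Ioo_of_forall_mem_Icc fun t ht => hN.norm_sub_le ht,
      ae_Ioo_of_forall_mem_Icc fun t ht => hB.norm_sub_le ht, Control.ae_norm_le u]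
      with t h1 h2 h3 x y
    have hsplit : controlledField N B u t x - controlledField N B u t y =
        (N t x - N t y) + (B t x - B t y) (u t) := by
      simp only [controlledField, _root_.sub_apply]
      abel
    have h4 : ‖(B t x - B t y) (u t)‖ ≤ L * ‖x - y‖ * ‖u‖ :=
      ((B t x - B t y).le_opNorm (u t)).trans
        (mul_le_mul (h2 x y) h3 (norm_nonneg _) ((norm_nonneg _).trans (h2 x y)))
    rw [hsplit]
    refine (norm_add_le _ _).trans ?_
    linarith [h1 x y]
  bdd := by
    refine ⟨(eLpNorm (fun t => N t 0) ⊤ (volume.restrict (Ioo t₀ T))).toReal +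
      inputSupNorm t₀ T B * ‖u‖, ?_⟩
    filter_upwards [(hN.memLp 0).exists_ae_norm_le, hB.ae_norm_le, Control.ae_norm_le u]
      with t h1 h2 h3
    exact (norm_add_le _ _).trans (add_le_add h1 (((B t 0).le_opNorm (u t)).trans
      (mul_le_mul (h2 0) h3 (norm_nonneg _) (inputSupNorm_nonneg B))))

variable (hΛ₁ : 0 < Λ₁) (hΛ₂ : 0 < Λ₂) (hL : 0 ≤ L) (htT : t₀ ≤ T) (x₀ : Vec d)
include hΛ₁ hL htT

theorem isSolutionOn_trajectory (u : Control k t₀ T) :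
    IsSolutionOn (controlledField N B u) t₀ T t₀ x₀ (trajectory N B x₀ u) :=
  (hB.isCaratheodory_controlledField hN u).isSolutionOn_solution (by positivity)
    ⟨le_rfl, htT⟩ x₀

theorem norm_trajectory_sub_le {ζ : ℝ} {u : Control k t₀ T} (hu : ‖u‖ ≤ ζ) (v : Control k t₀ T)
    {t : ℝ} (ht : t ∈ Icc t₀ T) :
    ‖trajectory N B x₀ u t - trajectory N B x₀ v t‖ ≤ inputSupNorm t₀ T B * ‖u - v‖ *
      ((Real.exp ((Λ₁ + L * ζ) * (t - t₀)) - 1) / (Λ₁ + L * ζ)) := by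
  have hζ : 0 ≤ ζ := (norm_nonneg u).trans hu
  have ht₀ : t₀ ∈ Icc t₀ T := ⟨le_rfl, htT⟩
  have hsu := hB.isSolutionOn_trajectory hN hΛ₁ hL htT x₀ u
  have hsv := hB.isSolutionOn_trajectory hN hΛ₁ hL htT x₀ v
  have hM := inputSupNorm_nonneg (t₀ := t₀) (T := T) B
  have := norm_le_of_const_source (K := Λ₁ + L * ζ) (c := inputSupNorm t₀ T B * ‖u - v‖)
    (by positivity) (by positivity) ht₀ (hsu.1.sub hsv.1)
    (fun t ht => by simpa using hsu.sub_eq hsv ht₀ ht) ?_ t ht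
  · rwa [abs_of_nonneg (sub_nonneg.2 ht.1)] at this
  filter_upwards [ae_Ioo_of_forall_mem_Icc fun t ht => hN.norm_sub_le ht,
    ae_Ioo_of_forall_mem_Icc fun t ht => hB.norm_sub_le ht, Control.ae_norm_le u,
    Control.ae_norm_le (u - v), Lp.coeFn_sub u v, hB.ae_norm_le] with r h1 h2 h3 h4 h5 h6
  set a := trajectory N B x₀ u r
  set b := trajectory N B x₀ v r
  rw [h5, Pi.sub_apply] at h4
  -- The increment of `B` is paired with `u` and the increment of the control with `B r b`: this
  -- yields the rate Λ₁ + Lζ and the constant source M‖u - v‖, and only `u` has to lie in the ball.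
  have hsplit : controlledField N B u r a - controlledField N B v r b =
      (N r a - N r b) + (B r a - B r b) (u r) + B r b (u r - v r) := by
    simp only [controlledField, _root_.sub_apply, map_sub]
    abel
  have h7 : ‖(B r a - B r b) (u r)‖ ≤ L * ‖a - b‖ * ζ :=
    ((B r a - B r b).le_opNorm (u r)).trans
      (mul_le_mul (h2 a b) (h3.trans hu) (norm_nonneg _) ((norm_nonneg _).trans (h2 a b)))
  have h8 : ‖B r b (u r - v r)‖ ≤ inputSupNorm t₀ T B * ‖u - v‖ :=
    ((B r b).le_opNorm _).trans (mul_le_mul (h6 b) h4 (norm_nonneg _) hM)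
  rw [hsplit]
  refine (norm_add₃_le).trans ?_
  change _ ≤ (Λ₁ + L * ζ) * ‖a - b‖ + _
  linarith [h1 a b]

theorem aestronglyMeasurable_gramianFactor {τ : ℝ} (hτ : τ ∈ Icc t₀ T) (u : Control k t₀ T) :
    AEStronglyMeasurable (gramianFactor N B x₀ τ u) (volume.restrict (Ioo t₀ T)) := by
  obtain ⟨X, hX, hXt⟩ : ∃ X : ℝ → Vec d, Continuous X ∧
      ∀ t ∈ Icc t₀ T, X t = trajectory N B x₀ u t :=
    ⟨fun t => trajectory N B x₀ u (projIcc t₀ T htT t),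
      (continuousOn_iff_continuous_domRestrict.1
        (hB.isSolutionOn_trajectory hN hΛ₁ hL htT x₀ u).1).comp continuous_projIcc,
      fun t ht => by simp only [projIcc_of_mem htT ht]⟩
  have h1 := hN.aestronglyMeasurable_fderiv_flow hΛ₁ hτ hX
  have h2 : AEStronglyMeasurable (fun t => B t (X t)) (volume.restrict (Ioo t₀ T)) :=
    aestronglyMeasurable_comp_of_continuous hB.aestronglyMeasurable_left
      (ae_Ioo_of_forall_mem_Icc fun t ht => (hB.contDiff t ht).continuous) hX.stronglyMeasurable
  have h3 : AEStronglyMeasurable (fun t : ℝ =>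
      (fderiv ℝ (flow N t₀ T t τ) (X t)).comp (B t (X t))) (volume.restrict (Ioo t₀ T)) :=
    (continuous_fst.clm_comp continuous_snd :
      Continuous fun p : (Vec d →L[ℝ] Vec d) × (Vec k →L[ℝ] Vec d) =>
        p.1.comp p.2).comp_aestronglyMeasurable (h1.prodMk h2)
  refine h3.congr (ae_Ioo_of_forall_mem_Icc fun t ht => ?_)
  simp only [gramianFactor, hXt t ht]

omit hL htT in
theorem ae_norm_gramianFactor_le {τ : ℝ} (hτ : τ ∈ Icc t₀ T) (u : Control k t₀ T) :
    ∀ᵐ t ∂(volume.restrict (Ioo t₀ T)),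
      ‖gramianFactor N B x₀ τ u t‖ ≤ Real.exp (Λ₁ * |t - τ|) * inputSupNorm t₀ T B := by
  filter_upwards [hB.ae_norm_le, ae_Ioo_of_forall_mem_Icc fun t ht => ht] with t h1 ht
  refine (ContinuousLinearMap.opNorm_comp_le _ _).trans ?_
  rw [abs_sub_comm]
  exact mul_le_mul (hN.norm_fderiv_flow_le hΛ₁ ht hτ _) (h1 _) (norm_nonneg _) (by positivity)

theorem intervalIntegrable_gramianIntegrand {τ : ℝ} (hτ : τ ∈ Icc t₀ T) (u : Control k t₀ T) :
    IntervalIntegrable (gramianIntegrand N B x₀ τ u) volume t₀ T := by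
  rw [intervalIntegrable_iff_integrableOn_Ioo_of_le htT]
  have hdom : IntegrableOn
      (fun t => (Real.exp (Λ₁ * |t - τ|) * inputSupNorm t₀ T B) *
        (Real.exp (Λ₁ * |t - τ|) * inputSupNorm t₀ T B)) (Ioo t₀ T) :=
    (Continuous.integrableOn_Icc (by fun_prop)).mono_set Ioo_subset_Icc_self
  have hm := hB.aestronglyMeasurable_gramianFactor hN hΛ₁ hL htT x₀ hτ u
  refine hdom.mono' (isBoundedBilinearMap_comp.continuous.comp_aestronglyMeasurable (hm.prodMk
    (ContinuousLinearMap.adjoint.continuous.comp_aestronglyMeasurable hm))) ?_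
  filter_upwards [hB.ae_norm_gramianFactor_le hN hΛ₁ x₀ hτ u] with t ht
  refine (ContinuousLinearMap.opNorm_comp_le _ _).trans ?_
  rw [LinearIsometryEquiv.norm_map]
  exact mul_le_mul ht ht (norm_nonneg _) ((norm_nonneg _).trans ht)

theorem isPositive_gramian {τ : ℝ} (hτ : τ ∈ Icc t₀ T) (u : Control k t₀ T) :
    (gramian N B x₀ τ u).IsPositive := by
  have hi := hB.intervalIntegrable_gramianIntegrand hN hΛ₁ hL htT x₀ hτ u
  have happ : ∀ x y : Vec d, inner ℝ (gramian N B x₀ τ u x) y =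
      ∫ t in t₀..T, inner ℝ (gramianIntegrand N B x₀ τ u t x) y := fun x y => by
    -- The functional A ↦ ⟨y, A x⟩ commutes with the integral, so symmetry and positivity pass from
    -- the integrand to the Gramian.
    have := ContinuousLinearMap.intervalIntegral_comp_comm
      ((innerSL ℝ y).comp (ContinuousLinearMap.apply ℝ (Vec d) x)) hi
    simp only [ContinuousLinearMap.comp_apply, ContinuousLinearMap.apply_apply,
      innerSL_apply_apply] at this
    rw [real_inner_comm, gramian, ← this]
    simp only [real_inner_comm]
  have hpos : ∀ t, (gramianIntegrand N B x₀ τ u t).IsPositive := fun t =>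
    ContinuousLinearMap.isPositive_self_comp_adjoint _
  rw [ContinuousLinearMap.isPositive_iff]
  refine ⟨fun x y => ?_, fun x => ?_⟩
  · change inner ℝ (gramian N B x₀ τ u x) y = inner ℝ x (gramian N B x₀ τ u y)
    rw [happ, ← real_inner_comm, happ]
    refine intervalIntegral.integral_congr fun t _ => ?_
    exact ((hpos t).isSymmetric x y).trans (real_inner_comm _ _)
  · rw [happ]
    exact intervalIntegral.integral_nonneg htT fun t _ => (hpos t).inner_nonneg_left x

include hΛ₂

/-- The integral is left unevaluated so that one estimate serves both base times. -/
theorem norm_gramian_sub_le {τ : ℝ} (hτ : τ ∈ Icc t₀ T) {ζ : ℝ} {u : Control k t₀ T}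
    (hu : ‖u‖ ≤ ζ) (v : Control k t₀ T) :
    ‖gramian N B x₀ τ u - gramian N B x₀ τ v‖ ≤
      (∫ t in t₀..T,
        (2 * L * inputSupNorm t₀ T B ^ 2 / (Λ₁ + L * ζ) *
          (Real.exp (Λ₁ * |t - τ|) ^ 2 * (Real.exp ((Λ₁ + L * ζ) * (t - t₀)) - 1)) +
        2 * inputSupNorm t₀ T B ^ 3 * Λ₂ / (Λ₁ * (Λ₁ + L * ζ)) *
          (Real.exp (Λ₁ * |t - τ|) ^ 2 * (Real.exp (Λ₁ * |t - τ|) - 1) *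
            (Real.exp ((Λ₁ + L * ζ) * (t - t₀)) - 1)))) * ‖u - v‖ := by
  have hζ : 0 ≤ ζ := (norm_nonneg u).trans hu
  rw [gramian, gramian, ← intervalIntegral.integral_sub
    (hB.intervalIntegrable_gramianIntegrand hN hΛ₁ hL htT x₀ hτ u)
    (hB.intervalIntegrable_gramianIntegrand hN hΛ₁ hL htT x₀ hτ v),
    ← intervalIntegral.integral_mul_const]
  refine intervalIntegral.norm_integral_le_of_norm_le htT ?_
    (Continuous.intervalIntegrable (by fun_prop) _ _)
  rw [← ae_restrict_iff' measurableSet_Ioc, ← restrict_Ioo_eq_restrict_Ioc]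
  filter_upwards [ae_Ioo_of_forall_mem_Icc fun t ht => ht, hB.ae_norm_le,
    hB.ae_norm_gramianFactor_le hN hΛ₁ x₀ hτ u,
    hB.ae_norm_gramianFactor_le hN hΛ₁ x₀ hτ v] with t ht hBt hKu hKv
  have hΔ := hB.norm_trajectory_sub_le hN hΛ₁ hL htT x₀ hu v ht
  have hX1 : 1 ≤ Real.exp (Λ₁ * |t - τ|) := Real.one_le_exp (by positivity)
  have hM := inputSupNorm_nonneg (t₀ := t₀) (T := T) B
  have hdiff : ‖gramianFactor N B x₀ τ u t - gramianFactor N B x₀ τ v t‖ ≤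
      Real.exp (Λ₁ * |t - τ|) *
        (L * ‖trajectory N B x₀ u t - trajectory N B x₀ v t‖) +
      Λ₂ * ‖trajectory N B x₀ u t - trajectory N B x₀ v t‖ *
        (Real.exp (Λ₁ * |t - τ|) * ((Real.exp (Λ₁ * |t - τ|) - 1) / Λ₁)) *
        inputSupNorm t₀ T B := by
    have hsplit : gramianFactor N B x₀ τ u t - gramianFactor N B x₀ τ v t =
        (fderiv ℝ (flow N t₀ T t τ) (trajectory N B x₀ u t)).comp
          (B t (trajectory N B x₀ u t) - B t (trajectory N B x₀ v t)) +
        (fderiv ℝ (flow N t₀ T t τ) (trajectory N B x₀ u t) -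
          fderiv ℝ (flow N t₀ T t τ) (trajectory N B x₀ v t)).comp
          (B t (trajectory N B x₀ v t)) := by
      rw [ContinuousLinearMap.comp_sub, ContinuousLinearMap.sub_comp, gramianFactor,
        gramianFactor]
      abel
    rw [hsplit, abs_sub_comm t τ]
    refine (norm_add_le _ _).trans (add_le_add ?_ ?_)
    · exact (ContinuousLinearMap.opNorm_comp_le _ _).trans (mul_le_mul
        (hN.norm_fderiv_flow_le hΛ₁ ht hτ _) (hB.norm_sub_le ht _ _) (norm_nonneg _)
        (by positivity))
    · have h1 := hN.norm_fderiv_flow_sub_le hΛ₁ hΛ₂ ht hτ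
        (trajectory N B x₀ u t) (trajectory N B x₀ v t)
      exact (ContinuousLinearMap.opNorm_comp_le _ _).trans (mul_le_mul h1 (hBt _)
        (norm_nonneg _) ((norm_nonneg _).trans h1))
  have hprod : ‖gramianIntegrand N B x₀ τ u t - gramianIntegrand N B x₀ τ v t‖ ≤
      ‖gramianFactor N B x₀ τ u t - gramianFactor N B x₀ τ v t‖ *
        (2 * (Real.exp (Λ₁ * |t - τ|) * inputSupNorm t₀ T B)) := by
    have hsplit : gramianIntegrand N B x₀ τ u t - gramianIntegrand N B x₀ τ v t =
        (gramianFactor N B x₀ τ u t - gramianFactor N B x₀ τ v t).comp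
          (ContinuousLinearMap.adjoint (gramianFactor N B x₀ τ u t)) +
        (gramianFactor N B x₀ τ v t).comp (ContinuousLinearMap.adjoint
          (gramianFactor N B x₀ τ u t - gramianFactor N B x₀ τ v t)) := by
      rw [ContinuousLinearMap.sub_comp, map_sub, ContinuousLinearMap.comp_sub,
        gramianIntegrand, gramianIntegrand]
      abel
    rw [hsplit]
    have h1 := (gramianFactor N B x₀ τ u t - gramianFactor N B x₀ τ v t).opNorm_comp_le
      (ContinuousLinearMap.adjoint (gramianFactor N B x₀ τ u t))
    have h2 := (gramianFactor N B x₀ τ v t).opNorm_comp_le (ContinuousLinearMap.adjoint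
          (gramianFactor N B x₀ τ u t - gramianFactor N B x₀ τ v t))
    rw [LinearIsometryEquiv.norm_map] at h1 h2
    have h3 := mul_le_mul_of_nonneg_left hKu
      (norm_nonneg (gramianFactor N B x₀ τ u t - gramianFactor N B x₀ τ v t))
    have h4 := mul_le_mul_of_nonneg_right hKv
      (norm_nonneg (gramianFactor N B x₀ τ u t - gramianFactor N B x₀ τ v t))
    refine (norm_add_le _ _).trans ?_
    linarith
  generalize ‖gramianFactor N B x₀ τ u t - gramianFactor N B x₀ τ v t‖ = G at hdiff hprod
  generalize ‖trajectory N B x₀ u t - trajectory N B x₀ v t‖ = Δ at hdiff hΔ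
  generalize Real.exp (Λ₁ * |t - τ|) = X at *
  generalize Real.exp ((Λ₁ + L * ζ) * (t - t₀)) = Y at *
  generalize inputSupNorm t₀ T B = M at *
  have hX0 : 0 ≤ X := by linarith
  have hX2 : 0 ≤ X - 1 := by linarith
  have hK : 0 < Λ₁ + L * ζ := by positivity
  calc _ ≤ G * (2 * (X * M)) := hprod
    _ ≤ (X * (L * (M * ‖u - v‖ * ((Y - 1) / (Λ₁ + L * ζ)))) +
        Λ₂ * (M * ‖u - v‖ * ((Y - 1) / (Λ₁ + L * ζ))) * (X * ((X - 1) / Λ₁)) * M) *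
        (2 * (X * M)) := by
      refine mul_le_mul_of_nonneg_right (hdiff.trans ?_) (by positivity)
      gcongr
    _ = _ := by
      field_simp

/-- With ζ = ‖u‖ the previous bound holds against every `v`, which gives continuity at `u` with no
localisation. -/
theorem continuous_gramian {τ : ℝ} (hτ : τ ∈ Icc t₀ T) :
    Continuous fun u : Control k t₀ T => gramian N B x₀ τ u := by
  rw [continuous_iff_continuousAt]
  intro u
  obtain ⟨C, hC⟩ : ∃ C, ∀ v, ‖gramian N B x₀ τ u - gramian N B x₀ τ v‖ ≤ C * ‖u - v‖ :=
    ⟨_, fun v => hB.norm_gramian_sub_le hN hΛ₁ hΛ₂ hL htT x₀ hτ le_rfl v⟩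
  refine tendsto_iff_norm_sub_tendsto_zero.2 ?_
  refine squeeze_zero (g := fun v => C * ‖u - v‖) (fun _ => norm_nonneg _)
    (fun v => by rw [norm_sub_rev]; exact hC v) ?_
  exact Continuous.tendsto' (by fun_prop) _ _ (by simp)

end IsSmoothInput

end Gramian

/-! ### Evaluation of the exponential integrals. -/

section ExpQuot

theorem sub_mul_expQuot (δ a b : ℝ) :
    (a - b) * expQuot δ a b = Real.exp (a * δ) - Real.exp (b * δ) := by
  unfold expQuot
  split_ifs with h
  · rw [h]; ring
  · rw [mul_div_cancel₀ _ (sub_ne_zero.2 h)]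

theorem expQuot_of_ne {a b : ℝ} (h : a ≠ b) (δ : ℝ) :
    expQuot δ a b = (Real.exp (a * δ) - Real.exp (b * δ)) / (a - b) := if_neg h

theorem expQuot_comm (δ a b : ℝ) : expQuot δ a b = expQuot δ b a := by
  rcases eq_or_ne a b with rfl | h
  · rfl
  · rw [expQuot_of_ne h, expQuot_of_ne h.symm, ← neg_sub b a, div_neg, ← neg_div, neg_sub]

theorem expQuot_add_add (δ a b c : ℝ) :
    expQuot δ (c + a) (c + b) = Real.exp (c * δ) * expQuot δ a b := by
  unfold expQuot
  simp only [add_right_inj, add_mul, Real.exp_add]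
  split_ifs
  · ring
  · rw [add_sub_add_left_eq_sub]; ring

/-- Identifies the quotient, resonant case a = b included, with an integral; this also shows that it
is nonnegative. -/
theorem integral_exp_mul_exp (t₀ T a b : ℝ) :
    ∫ t in t₀..T, Real.exp (a * (t - t₀)) * Real.exp (b * (T - t)) = expQuot (T - t₀) a b := by
  rcases eq_or_ne a b with rfl | h
  · have : ∀ t, Real.exp (a * (t - t₀)) * Real.exp (a * (T - t)) = Real.exp (a * (T - t₀)) :=
      fun t => by rw [← Real.exp_add]; ring_nf
    simp [this, expQuot]
  · have h' : a - b ≠ 0 := sub_ne_zero.2 h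
    have hd : ∀ t ∈ uIcc t₀ T, HasDerivAt
        (fun t => Real.exp (a * (t - t₀)) * Real.exp (b * (T - t)) / (a - b))
        (Real.exp (a * (t - t₀)) * Real.exp (b * (T - t))) t := fun t _ => by
      have h1 := (((hasDerivAt_id' t).sub_const t₀).const_mul a).exp
      have h2 := (((hasDerivAt_id' t).const_sub T).const_mul b).exp
      refine ((h1.mul h2).div_const (a - b)).congr_deriv ?_
      field_simp
      ring
    rw [intervalIntegral.integral_eq_sub_of_hasDerivAt hd
      (Continuous.intervalIntegrable (by fun_prop) _ _), expQuot_of_ne h]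
    simp only [sub_self, mul_zero, Real.exp_zero, one_mul, mul_one]
    ring

theorem expQuot_nonneg {δ : ℝ} (hδ : 0 ≤ δ) (a b : ℝ) : 0 ≤ expQuot δ a b := by
  have h := integral_exp_mul_exp 0 δ a b
  rw [sub_zero] at h
  rw [← h]
  exact intervalIntegral.integral_nonneg hδ fun t _ => by positivity

/-- The factor multiplying σ is nonnegative, so the value at σ = -1, which the integral attains, is
the smaller one. -/
theorem lipConst₁_le {Λ₁ Λ₂ L M ζ δ σ : ℝ} (hΛ₁ : 0 < Λ₁) (hL : 0 ≤ L) (hζ : 0 ≤ ζ)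
    (hδ : 0 ≤ δ) (hσ : -1 ≤ σ) :
    lipConst₁ (-1) Λ₁ Λ₂ L M ζ δ ≤ lipConst₁ σ Λ₁ Λ₂ L M ζ δ := by
  have h : 0 ≤ (Real.exp ((2 * Λ₁ + L * ζ) * δ) - Real.exp (-(Λ₁ * δ))) / (L * ζ + 3 * Λ₁) := by
    refine div_nonneg (sub_nonneg.2 (Real.exp_le_exp.2 ?_)) (by positivity)
    have : 0 ≤ (2 * Λ₁ + L * ζ) * δ := by positivity
    have : 0 ≤ Λ₁ * δ := by positivity
    linarith
  unfold lipConst₁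
  gcongr

theorem lipConst₂_le {Λ₁ Λ₂ L M ζ δ σ : ℝ} (hΛ₁ : 0 < Λ₁) (hΛ₂ : 0 ≤ Λ₂) (hL : 0 ≤ L)
    (hM : 0 ≤ M) (hζ : 0 ≤ ζ) (hδ : 0 ≤ δ) (hσ : -1 ≤ σ) :
    lipConst₂ (-1) Λ₁ Λ₂ L M ζ δ ≤ lipConst₂ σ Λ₁ Λ₂ L M ζ δ := by
  have h := expQuot_nonneg hδ Λ₁ (L * ζ)
  unfold lipConst₂
  gcongr

theorem integral_exp_combination (t₀ T c₁ c₂ a₁ a₂ a₃ a₄ b₁ b₂ b₃ b₄ : ℝ) :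
    (∫ t in t₀..T,
      (c₁ * (Real.exp (a₁ * (t - t₀)) * Real.exp (b₁ * (T - t)) -
          Real.exp (a₂ * (t - t₀)) * Real.exp (b₂ * (T - t))) +
        c₂ * (Real.exp (a₃ * (t - t₀)) * Real.exp (b₃ * (T - t)) -
          Real.exp (a₁ * (t - t₀)) * Real.exp (b₁ * (T - t)) -
          Real.exp (a₄ * (t - t₀)) * Real.exp (b₄ * (T - t)) +
          Real.exp (a₂ * (t - t₀)) * Real.exp (b₂ * (T - t))))) =
      c₁ * (expQuot (T - t₀) a₁ b₁ - expQuot (T - t₀) a₂ b₂) +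
        c₂ * (expQuot (T - t₀) a₃ b₃ - expQuot (T - t₀) a₁ b₁ - expQuot (T - t₀) a₄ b₄ +
          expQuot (T - t₀) a₂ b₂) := by
  have hi : ∀ a b : ℝ, IntervalIntegrable
      (fun t => Real.exp (a * (t - t₀)) * Real.exp (b * (T - t))) volume t₀ T := fun a b =>
    Continuous.intervalIntegrable (by fun_prop) _ _
  rw [intervalIntegral.integral_add (((hi _ _).sub (hi _ _)).const_mul _)
      (((((hi _ _).sub (hi _ _)).sub (hi _ _)).add (hi _ _)).const_mul _),
    intervalIntegral.integral_const_mul, intervalIntegral.integral_const_mul,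
    intervalIntegral.integral_sub (hi _ _) (hi _ _),
    intervalIntegral.integral_add (((hi _ _).sub (hi _ _)).sub (hi _ _)) (hi _ _),
    intervalIntegral.integral_sub ((hi _ _).sub (hi _ _)) (hi _ _),
    intervalIntegral.integral_sub (hi _ _) (hi _ _)]
  simp only [integral_exp_mul_exp]

/-- Here X and Y both grow with t - t₀, so all exponents are positive and no resonance occurs. -/
theorem integral_gramian_bound_left {t₀ T Λ₁ : ℝ} (htT : t₀ ≤ T) (hΛ₁ : 0 < Λ₁)
    {L ζ : ℝ} (hL : 0 ≤ L) (hζ : 0 ≤ ζ) (M Λ₂ : ℝ) :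
    (∫ t in t₀..T,
      (2 * L * M ^ 2 / (Λ₁ + L * ζ) *
          (Real.exp (Λ₁ * |t - t₀|) ^ 2 * (Real.exp ((Λ₁ + L * ζ) * (t - t₀)) - 1)) +
        2 * M ^ 3 * Λ₂ / (Λ₁ * (Λ₁ + L * ζ)) *
          (Real.exp (Λ₁ * |t - t₀|) ^ 2 * (Real.exp (Λ₁ * |t - t₀|) - 1) *
            (Real.exp ((Λ₁ + L * ζ) * (t - t₀)) - 1)))) =
      lipConst₁ (-1) Λ₁ Λ₂ L M ζ (T - t₀) := by
  have hb : 0 ≤ L * ζ := by positivity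
  have hcomb := integral_exp_combination t₀ T (2 * L * M ^ 2 / (Λ₁ + L * ζ))
    (2 * M ^ 3 * Λ₂ / (Λ₁ * (Λ₁ + L * ζ))) (3 * Λ₁ + L * ζ) (2 * Λ₁) (4 * Λ₁ + L * ζ) (3 * Λ₁)
    0 0 0 0
  rw [intervalIntegral.integral_congr (g := _) fun t ht => ?_, hcomb]
  · rw [expQuot_of_ne (by positivity), expQuot_of_ne (by positivity),
      expQuot_of_ne (by positivity), expQuot_of_ne (by positivity)]
    unfold lipConst₁
    set δ := T - t₀
    generalize L * ζ = b at *
    have e1 : Real.exp ((3 * Λ₁ + b) * δ) = Real.exp (Λ₁ * δ) ^ 3 * Real.exp (b * δ) := by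
      rw [← Real.exp_nat_mul, ← Real.exp_add]; push_cast; ring_nf
    have e2 : Real.exp ((2 * Λ₁ + b) * δ) = Real.exp (Λ₁ * δ) ^ 2 * Real.exp (b * δ) := by
      rw [← Real.exp_nat_mul, ← Real.exp_add]; push_cast; ring_nf
    have e3 : Real.exp ((4 * Λ₁ + b) * δ) = Real.exp (Λ₁ * δ) ^ 4 * Real.exp (b * δ) := by
      rw [← Real.exp_nat_mul, ← Real.exp_add]; push_cast; ring_nf
    have e4 : Real.exp (2 * Λ₁ * δ) = Real.exp (Λ₁ * δ) ^ 2 := by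
      rw [← Real.exp_nat_mul]; push_cast; ring_nf
    have e5 : Real.exp (3 * Λ₁ * δ) = Real.exp (Λ₁ * δ) ^ 3 := by
      rw [← Real.exp_nat_mul]; push_cast; ring_nf
    rw [e1, e2, e3, e4, e5, Real.exp_neg]
    simp only [zero_mul, Real.exp_zero, sub_zero]
    have hX := Real.exp_pos (Λ₁ * δ)
    generalize Real.exp (Λ₁ * δ) = X at *
    generalize Real.exp (b * δ) = Y at *
    have h1 : Λ₁ + b ≠ 0 := by positivity
    have h2 : 3 * Λ₁ + b ≠ 0 := by positivity
    have h3 : b + 3 * Λ₁ ≠ 0 := by positivity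
    have h4 : 4 * Λ₁ + b ≠ 0 := by positivity
    field_simp
    ring
  · simp only [zero_mul, Real.exp_zero, mul_one]
    rw [uIcc_of_le htT] at ht
    rw [abs_of_nonneg (sub_nonneg.2 ht.1)]
    set r := t - t₀
    have e0 : Real.exp ((Λ₁ + L * ζ) * r) = Real.exp (Λ₁ * r) * Real.exp (L * ζ * r) := by
      rw [← Real.exp_add]; ring_nf
    have e1 : Real.exp ((3 * Λ₁ + L * ζ) * r) = Real.exp (Λ₁ * r) ^ 3 * Real.exp (L * ζ * r) := by
      rw [← Real.exp_nat_mul, ← Real.exp_add]; push_cast; ring_nf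
    have e3 : Real.exp ((4 * Λ₁ + L * ζ) * r) = Real.exp (Λ₁ * r) ^ 4 * Real.exp (L * ζ * r) := by
      rw [← Real.exp_nat_mul, ← Real.exp_add]; push_cast; ring_nf
    have e4 : Real.exp (2 * Λ₁ * r) = Real.exp (Λ₁ * r) ^ 2 := by
      rw [← Real.exp_nat_mul]; push_cast; ring_nf
    have e5 : Real.exp (3 * Λ₁ * r) = Real.exp (Λ₁ * r) ^ 3 := by
      rw [← Real.exp_nat_mul]; push_cast; ring_nf
    rw [e0, e1, e3, e4, e5]
    ring

/-- Here X decays in t while Y grows, so the rates Λ₁ + Lζ and 2Λ₁ or 3Λ₁ may coincide. Factoring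
out exp(Λ₁δ) leaves the quotients at (Λ₁, Lζ) and (2Λ₁, Lζ). -/
theorem integral_gramian_bound_right {t₀ T Λ₁ : ℝ} (htT : t₀ ≤ T) (hΛ₁ : 0 < Λ₁)
    {L ζ : ℝ} (hL : 0 ≤ L) (hζ : 0 ≤ ζ) (M Λ₂ : ℝ) :
    (∫ t in t₀..T,
      (2 * L * M ^ 2 / (Λ₁ + L * ζ) *
          (Real.exp (Λ₁ * |t - T|) ^ 2 * (Real.exp ((Λ₁ + L * ζ) * (t - t₀)) - 1)) +
        2 * M ^ 3 * Λ₂ / (Λ₁ * (Λ₁ + L * ζ)) *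
          (Real.exp (Λ₁ * |t - T|) ^ 2 * (Real.exp (Λ₁ * |t - T|) - 1) *
            (Real.exp ((Λ₁ + L * ζ) * (t - t₀)) - 1)))) =
      lipConst₂ (-1) Λ₁ Λ₂ L M ζ (T - t₀) := by
  have hb : 0 ≤ L * ζ := by positivity
  have hcomb := integral_exp_combination t₀ T (2 * L * M ^ 2 / (Λ₁ + L * ζ))
    (2 * M ^ 3 * Λ₂ / (Λ₁ * (Λ₁ + L * ζ))) (Λ₁ + L * ζ) 0 (Λ₁ + L * ζ) 0
    (2 * Λ₁) (2 * Λ₁) (3 * Λ₁) (3 * Λ₁)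
  rw [intervalIntegral.integral_congr (g := _) fun t ht => ?_, hcomb]
  · have q1 : expQuot (T - t₀) (Λ₁ + L * ζ) (2 * Λ₁) =
        Real.exp (Λ₁ * (T - t₀)) * expQuot (T - t₀) Λ₁ (L * ζ) := by
      rw [two_mul, expQuot_add_add, expQuot_comm]
    have q2 : expQuot (T - t₀) (Λ₁ + L * ζ) (3 * Λ₁) =
        Real.exp (Λ₁ * (T - t₀)) * expQuot (T - t₀) (2 * Λ₁) (L * ζ) := by
      rw [show 3 * Λ₁ = Λ₁ + 2 * Λ₁ by ring, expQuot_add_add, expQuot_comm]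
    have q3 := sub_mul_expQuot (T - t₀) Λ₁ (L * ζ)
    have q4 : 2 * Λ₁ ≠ 0 := by positivity
    have q5 : 3 * Λ₁ ≠ 0 := by positivity
    rw [q1, q2, expQuot_of_ne q4.symm, expQuot_of_ne q5.symm]
    unfold lipConst₂
    set δ := T - t₀
    generalize expQuot δ Λ₁ (L * ζ) = E at *
    generalize expQuot δ (2 * Λ₁) (L * ζ) = F at *
    generalize L * ζ = b at *
    have e4 : Real.exp (2 * Λ₁ * δ) = Real.exp (Λ₁ * δ) ^ 2 := by
      rw [← Real.exp_nat_mul]; push_cast; ring_nf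
    have e5 : Real.exp (3 * Λ₁ * δ) = Real.exp (Λ₁ * δ) ^ 3 := by
      rw [← Real.exp_nat_mul]; push_cast; ring_nf
    rw [e4, e5, Real.exp_neg]
    simp only [zero_mul, Real.exp_zero, zero_sub]
    have hX := Real.exp_pos (Λ₁ * δ)
    generalize Real.exp (Λ₁ * δ) = X at *
    generalize Real.exp (b * δ) = Y at *
    have h1 : Λ₁ + b ≠ 0 := by positivity
    have h2 : b + Λ₁ ≠ 0 := by positivity
    -- Eliminating exp(bδ) through (Λ₁ - b)E = X - Y avoids dividing by Λ₁ - b, so the resonant case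
    -- needs no separate treatment.
    obtain rfl : Y = X - (Λ₁ - b) * E := by linarith
    field_simp
    ring
  · simp only [zero_mul, Real.exp_zero, one_mul]
    rw [uIcc_of_le htT] at ht
    rw [abs_sub_comm, abs_of_nonneg (sub_nonneg.2 ht.2)]
    have e4 : Real.exp (2 * Λ₁ * (T - t)) = Real.exp (Λ₁ * (T - t)) ^ 2 := by
      rw [← Real.exp_nat_mul]; push_cast; ring_nf
    have e5 : Real.exp (3 * Λ₁ * (T - t)) = Real.exp (Λ₁ * (T - t)) ^ 3 := by
      rw [← Real.exp_nat_mul]; push_cast; ring_nf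
    rw [e4, e5]
    ring

end ExpQuot

theorem lemma3p11 (d k : ℕ) (t₀ T : ℝ) (htT : t₀ < T)
    (N : ℝ → Vec d → Vec d) (B : ℝ → Vec d → (Vec k →L[ℝ] Vec d))
    (Λ₁ Λ₂ L_B : ℝ) (hΛ₁ : 0 < Λ₁) (hΛ₂ : 0 < Λ₂) (hL_B : 0 ≤ L_B)
    -- the drift
    (hN_bdd : ∀ x : Vec d,
      MemLp (fun t => N t x) ⊤ ((volume : Measure ℝ).restrict (Ioo t₀ T)))
    (hN_smooth : ∀ t ∈ Icc t₀ T, ContDiff ℝ 2 (N t))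
    (hN_D1 : ∀ t ∈ Icc t₀ T, ∀ w : Vec d, ‖fderiv ℝ (N t) w‖ ≤ Λ₁)
    (hN_D2 : ∀ t ∈ Icc t₀ T, ∀ w : Vec d, ‖fderiv ℝ (fderiv ℝ (N t)) w‖ ≤ Λ₂)
    -- the input matrix
    (hB_bdd : MemLp (fun p : ℝ × Vec d => B p.1 p.2) ⊤
      (((volume : Measure ℝ).restrict (Ioo t₀ T)).prod (volume : Measure (Vec d))))
    (hB_smooth : ∀ t ∈ Icc t₀ T, ContDiff ℝ 1 (B t))
    (hB_D1 : ∀ t ∈ Icc t₀ T, ∀ w : Vec d, ‖fderiv ℝ (B t) w‖ ≤ L_B)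
    (x₀ : Vec d) :
    -- the flow and the trajectories are well defined
    ((∀ s ∈ Icc t₀ T, ∀ ξ : Vec d, HasUniqueSolutionOn N t₀ T s ξ) ∧
      (∀ s ∈ Icc t₀ T, ∀ t ∈ Icc t₀ T, Differentiable ℝ (flow N t₀ T s t)) ∧
      (∀ u : Control k t₀ T, HasUniqueSolutionOn (controlledField N B u) t₀ T t₀ x₀)) ∧
    -- both Gramian maps are well defined, take positive semidefinite values, and are continuous
    (∀ τ : ℝ, τ = t₀ ∨ τ = T →
      (∀ u : Control k t₀ T,
        IntervalIntegrable (gramianIntegrand N B x₀ τ u) volume t₀ T ∧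
        (gramian N B x₀ τ u).IsPositive) ∧
      Continuous (fun u : Control k t₀ T => gramian N B x₀ τ u)) ∧
    -- Lipschitz bounds on balls
    (∀ ζ : ℝ, 0 ≤ ζ → ∀ u v : Control k t₀ T, ‖u‖ ≤ ζ → ‖v‖ ≤ ζ →
      ∀ σ : ℝ, σ = 1 ∨ σ = -1 →
        ‖gramian N B x₀ t₀ u - gramian N B x₀ t₀ v‖ ≤
          lipConst₁ σ Λ₁ Λ₂ L_B (inputSupNorm t₀ T B) ζ (T - t₀) * ‖u - v‖ ∧
        ‖gramian N B x₀ T u - gramian N B x₀ T v‖ ≤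
          lipConst₂ σ Λ₁ Λ₂ L_B (inputSupNorm t₀ T B) ζ (T - t₀) * ‖u - v‖) := by
  have hN : IsSmoothDrift N t₀ T Λ₁ Λ₂ := ⟨hN_bdd, hN_smooth, hN_D1, hN_D2⟩
  have hB : IsSmoothInput B t₀ T L_B := ⟨hB_bdd, hB_smooth, hB_D1⟩
  have hle := htT.le
  have hC := hN.isCaratheodory
  have h₀ : t₀ ∈ Icc t₀ T := ⟨le_rfl, hle⟩
  have h₁ : T ∈ Icc t₀ T := ⟨hle, le_rfl⟩
  refine ⟨⟨fun s hs ξ => hC.hasUniqueSolutionOn hΛ₁.le hs ξ,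
    fun s hs t ht => hN.differentiable_flow hΛ₁ hΛ₂ hs ht,
    fun u => (hB.isCaratheodory_controlledField hN u).hasUniqueSolutionOn (by positivity) h₀ x₀⟩,
    fun τ hτ => ?_, fun ζ hζ u v hu hv σ hσ => ⟨?_, ?_⟩⟩
  · have hτ' : τ ∈ Icc t₀ T := by rcases hτ with rfl | rfl <;> assumption
    exact ⟨fun u => ⟨hB.intervalIntegrable_gramianIntegrand hN hΛ₁ hL_B hle x₀ hτ' u,
      hB.isPositive_gramian hN hΛ₁ hL_B hle x₀ hτ' u⟩,
      hB.continuous_gramian hN hΛ₁ hΛ₂ hL_B hle x₀ hτ'⟩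
  · have h := hB.norm_gramian_sub_le hN hΛ₁ hΛ₂ hL_B hle x₀ h₀ hu v
    rw [integral_gramian_bound_left hle hΛ₁ hL_B hζ] at h
    refine h.trans (mul_le_mul_of_nonneg_right (lipConst₁_le hΛ₁ hL_B hζ (by linarith) ?_)
      (norm_nonneg _))
    rcases hσ with rfl | rfl <;> norm_num
  · have h := hB.norm_gramian_sub_le hN hΛ₁ hΛ₂ hL_B hle x₀ h₁ hu v
    rw [integral_gramian_bound_right hle hΛ₁ hL_B hζ] at h
    refine h.trans (mul_le_mul_of_nonneg_right (lipConst₂_le hΛ₁ hΛ₂.le hL_B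
      (inputSupNorm_nonneg B) hζ (by linarith) ?_) (norm_nonneg _))
    rcases hσ with rfl | rfl <;> norm_num
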